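/- Let $d\ge 3$, $r\ge 2$ and $n_1,\dots,n_d\ge r^2$; mode numbers are read modulo $d$. For cores $\mathcal Q_k\in\mathbb C^{n_k\times r\times r}$ with slices $Q_k^{(a)}\in\mathbb C^{r\times r}$ let $T\in\mathbb C^{n_1\times\cdots\times n_d}$ be the tensor $T(x_1,\dots,x_d)=\operatorname{tr}\bigl(Q_1^{(x_1)}Q_2^{(x_2)}\cdots Q_d^{(x_d)}\bigr)$. Suppose that the entries of all cores are drawn from a joint probability law $\mu$ on $\prod_k\mathbb C^{n_k\times r\times r}$ that is absolutely continuous with respect to Lebesgue measure. *Notation.* The columns of $r^2$-column matrices are numbered by pairs $(i,j)\in[r]^2$, $(i,j)$ being number $(i-1)r+j$. For a core $\mathcal Q$ put $Q_{\langle1\rangle}(a,(i,j))=Q^{(a)}_{ij}$ and $Q_{[1]}(a,(i,j))=Q^{(a)}_{ji}$. For an $r^2\times r^2$ matrix, $\Pi(X)_{(j_2,j_1),(k_2,k_1)}=X_{(j_1,j_2),(k_1,k_2)}$. $A^\dagger$ is the Moore–Penrose inverse. For $\alpha\in[n_2]\times\cdots\times[n_{d-1}]$ and $S\subseteq[n_d]$,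 $T(:,\alpha,S)$ is the $n_1\times|S|$ matrix of the entries $T(a,\alpha,b)$, $a\in[n_1]$, $b\in S$. For $\gamma\in[n_1]\times\cdots\times[n_d]$, $k\in[d]$ and $G\subseteq[n_k]$, $T_k(\gamma,G)$ is the $n_{k+1}\times|G|$ matrix of the entries of $T$ whose index in mode $k+1$ is the row number, whose index in mode $k$ is the column number in $G$, and whose index in any other mode $j$ is $\gamma_j$. *Index choices.* Choose $\alpha,\beta,\alpha',\beta'\in[n_2]\times\cdots\times[n_{d-1}]$, sets $S,S'\subseteq[n_d]$ and $G_k\subseteq[n_k]$ ($k\in[d]$) with $r^2$ elements each, and $\gamma\in[n_1]\times\cdots\times[n_d]$. The choice is admissible if $\alpha\ne\beta$, $\alpha'\ne\beta'$ and the following holds: if $m$ and $m'$ are the largest modes with $\alpha_m\neq\beta_m$ and $\alpha'_{m'}\ne\beta'_{m'}$, then $m\neq m'$ or $\{\alpha_{\le m},\beta_{\le m}\}\ne\{\alpha'_{\le m},\beta'_{\le m}\}$, where $\alpha_{\le m}=(\alpha_2,\dots,\alpha_m)$. (For $d=3$ the last condition says $\{\alpha,\beta\}\ne\{\alpha',\beta'\}$.)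 Let $\Delta$ be the set of positions of the entries in $T(:,\alpha,S)$, $T(:,\beta,S)$, $T(:,\alpha',S')$, $T(:,\beta',S')$ and $T_k(\gamma,G_k)$, $k\in[d]$. *The algorithm (BLOSTR)* receives only $r$, an admissible choice and the entries of $T$ at $\Delta$, and performs these steps in exact arithmetic. 1. Find $E,E'\in\mathbb C^{n_1\times r^2}$ whose columns are bases of eigenvectors for the nonzero spectrum of $T(:,\alpha,S)\,T(:,\beta,S)^\dagger$ and $T(:,\alpha',S')\,T(:,\beta',S')^\dagger$, respectively, arranged so that, for $r$ distinct nonzero eigenvalues $\lambda_1,\dots,\lambda_r$ in any order, column $(j,k)$ belongs to $\lambda_k$. 2. Put $F=E^\dagger E'$ and $F^{(j,k)}=\bigl(F_{(a,j),(b,k)}\bigr)_{a,b\in[r]}$. 3. Put $\hat K_1=I_r$ and $\hat K_\ell=F^{(1,1)}(F^{(\ell,1)})^{-1}$ for $2\le\ell\le r$. 4. Define $\hat{\mathcal Q}_1$ by $\hat Q_{1\langle1\rangle}=E\,\bigl(\Pi(\operatorname{blockdiag}(\hat K_1,\dots,\hat K_r))\bigr)^{-1}$. 5. For $k=2,\dots,d$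 (one step each) define $\hat{\mathcal Q}_k$ by $$\hat Q_{k\langle1\rangle}=T_{k-1}(\gamma,G_{k-1})\Bigl(\bigl(I_r\otimes(\hat Q_1^{(\gamma_1)}\cdots\hat Q_{k-2}^{(\gamma_{k-2})})\bigr)\,\hat Q_{(k-1)[1]}^{\top}(:,G_{k-1})\Bigr)^\dagger ,$$ the product in the inner parentheses being $I_r$ for $k=2$. Then admissible choices exist, and for each of them $|\Delta|\le 5r^2\sum_{k}n_k$, so that the algorithm uses only $O(r^2\sum_k n_k)$ entries of $T$. Moreover, with probability one, for every admissible choice and every choice of the eigenbases in step 1, all steps of the algorithm can be carried out (in particular such eigenbases exist and all matrices to be inverted are invertible), it stops after exactly $d+3$ steps, and its output recovers the cores up to gauge: there are $L_1,\dots,L_d\in GL(r,\mathbb C)$ with $\hat Q_k^{(a)}=L_k^{-1}Q_k^{(a)}L_{k+1}$ for all $k\in[d]$ and $a\in[n_k]$, where $L_{d+1}=L_1$. -/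

import Mathlib

open MeasureTheory
open scoped Kronecker

noncomputable section

namespace TensorRing

/-- Multi-indices of an order-`d` tensor with mode sizes `n k`. Modes are numbered `0, …, d - 1`,
and addition on `Fin d` is cyclic. -/
abbrev Index {d : ℕ} (n : Fin d → ℕ) : Type := (k : Fin d) → Fin (n k)

/-- Families of `d` cores, the `k`-th one of size `n k × r × r`. `Q k a` is the `a`-th slice. -/
abbrev Cores {d : ℕ} (n : Fin d → ℕ) (r : ℕ) : Type :=
  (k : Fin d) → Fin (n k) → Fin r → Fin r → ℂ

/-- The slice `Q_k^{(a)}` as an `r × r` matrix. -/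
def coreSlice {d r : ℕ} {n : Fin d → ℕ} (Q : Cores n r) (k : Fin d) (a : Fin (n k)) :
    Matrix (Fin r) (Fin r) ℂ :=
  Matrix.of (Q k a)

/-- The tensor with given cores: `T(x) = tr (Q_0^{(x_0)} Q_1^{(x_1)} ⋯ Q_{d-1}^{(x_{d-1})})`. -/
def ringTensor {d r : ℕ} {n : Fin d → ℕ} (Q : Cores n r) (x : Index n) : ℂ :=
  Matrix.trace (List.ofFn fun k : Fin d => coreSlice Q k (x k)).prod

/-- Gauge equivalence: `Q'_k^{(a)} = L_k⁻¹ Q_k^{(a)} L_{k+1}` for invertible `L_k`, with `k + 1`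
taken modulo `d`. -/
def GaugeEquiv {d r : ℕ} [NeZero d] {n : Fin d → ℕ} (Q Q' : Cores n r) : Prop :=
  ∃ L : Fin d → GL (Fin r) ℂ, ∀ (k : Fin d) (a : Fin (n k)),
    coreSlice Q' k a = ((L k)⁻¹ : GL (Fin r) ℂ).val * coreSlice Q k a * (L (k + 1)).val

/-- The unfolding `A_{⟨1⟩}` of an `m × r × r` array. The pair `(i, j)` stands for the column
number `(i - 1) r + j`. -/
def unfoldAngle {m r : ℕ} (A : Fin m → Fin r → Fin r → ℂ) :
    Matrix (Fin m) (Fin r × Fin r) ℂ :=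
  Matrix.of fun a ij => A a ij.1 ij.2

/-- The unfolding `A_{[1]}` of an `m × r × r` array, with columns numbered in the same way. -/
def unfoldBracket {m r : ℕ} (A : Fin m → Fin r → Fin r → ℂ) :
    Matrix (Fin m) (Fin r × Fin r) ℂ :=
  Matrix.of fun a ij => A a ij.2 ij.1

/-- The inverse operation of `unfoldAngle`. -/
def reshape {m r : ℕ} (Y : Matrix (Fin m) (Fin r × Fin r) ℂ) : Fin m → Fin r → Fin r → ℂ :=
  fun a i j => Y a (i, j)

/-- The block-diagonal `r² × r²` matrix with diagonal blocks `K 0, …, K (r - 1)`. -/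
def blockDiag {r : ℕ} (K : Fin r → Matrix (Fin r) (Fin r) ℂ) :
    Matrix (Fin r × Fin r) (Fin r × Fin r) ℂ :=
  Matrix.of fun x y => if x.1 = y.1 then K x.1 x.2 y.2 else 0

/-- The permutation operation `Π` on the rows and columns of an `r² × r²` matrix. -/
def permPi {r : ℕ} (X : Matrix (Fin r × Fin r) (Fin r × Fin r) ℂ) :
    Matrix (Fin r × Fin r) (Fin r × Fin r) ℂ :=
  X.submatrix Prod.swap Prod.swap

/-- The block `F^{(j,k)}`: rows `j, r + j, 2r + j, …` and columns `k, r + k, 2r + k, …` of `F`. -/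
def subBlock {r : ℕ} (F : Matrix (Fin r × Fin r) (Fin r × Fin r) ℂ) (j k : Fin r) :
    Matrix (Fin r) (Fin r) ℂ :=
  Matrix.of fun a b => F (a, j) (b, k)

/-- `X` is the Moore–Penrose inverse of `A` (the four Penrose equations). -/
def IsMoorePenrose {p q : Type} [Fintype p] [Fintype q] (A : Matrix p q ℂ) (X : Matrix q p ℂ) :
    Prop :=
  A * X * A = A ∧ X * A * X = X ∧ (A * X).conjTranspose = A * X ∧
    (X * A).conjTranspose = X * A

/-- The columns of `E` are eigenvectors of `A` for its nonzero spectrum, grouped as the algorithm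
wants them: the nonzero eigenvalues are `r` distinct numbers `lam k`, taken in some order, and
column `(j, k)` is the `j`-th vector of a basis of the eigenspace of `lam k`. -/
def IsEigenbasis {m r : ℕ} (A : Matrix (Fin m) (Fin m) ℂ)
    (E : Matrix (Fin m) (Fin r × Fin r) ℂ) : Prop :=
  ∃ lam : Fin r → ℂ, Function.Injective lam ∧ (∀ k, lam k ≠ 0) ∧
    (∀ j k, A.mulVec (E.col (j, k)) = lam k • E.col (j, k)) ∧
    LinearIndependent ℂ E.col ∧
    ∀ (z : ℂ) (v : Fin m → ℂ), z ≠ 0 → A.mulVec v = z • v →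
      v ∈ Submodule.span ℂ (Set.range E.col)

/-- The last mode. -/
def lastMode (d : ℕ) [NeZero d] : Fin d := ⟨d - 1, Nat.sub_lt (NeZero.pos d) Nat.one_pos⟩

/-- The middle modes: all modes but the first and the last one. -/
def IsMid {d : ℕ} [NeZero d] (k : Fin d) : Prop := k ≠ 0 ∧ k ≠ lastMode d

/-- The multi-index with entry `a` in mode `i`, entry `b` in mode `j`, and the entries of `x` in
all other modes. -/
def place {d : ℕ} {n : Fin d → ℕ} (x : Index n) (i j : Fin d) (a : Fin (n i)) (b : Fin (n j)) :
    Index n :=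
  Function.update (Function.update x i a) j b

/-- The positions of the entries of a matrix slice: mode `i` is free, mode `j` runs through `S`,
and all other modes are fixed to the entries of `x`. -/
def slicePositions {d : ℕ} {n : Fin d → ℕ} (x : Index n) (i j : Fin d) (S : Finset (Fin (n j))) :
    Finset (Index n) :=
  ((Finset.univ : Finset (Fin (n i))) ×ˢ S).image fun ab => place x i j ab.1 ab.2

/-- `m` is the largest middle mode in which `x` and `y` differ. -/
def IsLastDiff {d : ℕ} [NeZero d] {n : Fin d → ℕ} (x y : Index n) (m : Fin d) : Prop :=
  IsMid m ∧ x m ≠ y m ∧ ∀ k, IsMid k → m < k → x k = y k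

/-- `x` and `y` agree in all middle modes up to `m`. -/
def AgreeUpTo {d : ℕ} [NeZero d] {n : Fin d → ℕ} (m : Fin d) (x y : Index n) : Prop :=
  ∀ k, IsMid k → k ≤ m → x k = y k

/-- The index choices that the algorithm works with: two probe pairs `(α, β)` and `(α', β')`, of
which only the middle entries are used, the column sets `S` and `S'` of the two probes, the
multi-index `γ`, and the column sets `G k` for the sequential solves. -/
structure Choice {d : ℕ} [NeZero d] (n : Fin d → ℕ) where
  α : Index n
  β : Index n
  α' : Index n
  β' : Index n
  S : Finset (Fin (n (lastMode d)))
  S' : Finset (Fin (n (lastMode d)))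
  γ : Index n
  G : (k : Fin d) → Finset (Fin (n k))

namespace Choice

variable {d : ℕ} [NeZero d] {n : Fin d → ℕ}

/-- All column sets have `r²` elements, the middle parts satisfy `α ≠ β` and `α' ≠ β'`, and the
pairs `{α, β}` and `{α', β'}` are different, even after the common final entries of `α` and `β`,
and those of `α'` and `β'`, have been deleted. (Those entries cancel in
`R^α (R^β)⁻¹`, where `R^α` is the product of the slices that `α` selects in the middle modes.) -/
def Admissible (P : Choice n) (r : ℕ) : Prop :=
  P.S.card = r ^ 2 ∧ P.S'.card = r ^ 2 ∧ (∀ k, (P.G k).card = r ^ 2) ∧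
    ∃ m m' : Fin d, IsLastDiff P.α P.β m ∧ IsLastDiff P.α' P.β' m' ∧
      (m = m' → ¬ (AgreeUpTo m P.α P.α' ∧ AgreeUpTo m P.β P.β') ∧
        ¬ (AgreeUpTo m P.α P.β' ∧ AgreeUpTo m P.β P.α'))

/-- The set `Δ` of positions of the observed entries. -/
def Δ (P : Choice n) : Finset (Index n) :=
  (slicePositions P.α 0 (lastMode d) P.S ∪ slicePositions P.β 0 (lastMode d) P.S) ∪
  (slicePositions P.α' 0 (lastMode d) P.S' ∪ slicePositions P.β' 0 (lastMode d) P.S') ∪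
  Finset.univ.biUnion fun k : Fin d => slicePositions P.γ (k + 1) k (P.G k)

end Choice

/-- Reading an observed entry. The default value is never used by the algorithm, which reads only
positions in `D`. -/
def readEntry {d : ℕ} {n : Fin d → ℕ} {D : Finset (Index n)} (obs : D → ℂ) (x : Index n) : ℂ :=
  if h : x ∈ D then obs ⟨x, h⟩ else 0

/-- The matrix slice with rows in mode `i`, columns in mode `j` restricted to `S`, and all other
modes fixed to the entries of `x`. -/
def obsSlice {d : ℕ} {n : Fin d → ℕ} {D : Finset (Index n)} (obs : D → ℂ)
    (x : Index n) (i j : Fin d) (S : Finset (Fin (n j))) : Matrix (Fin (n i)) S ℂ :=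
  Matrix.of fun a b => readEntry obs (place x i j a b.1)

/-- The states of the algorithm. In `cores m Q` the first `m` cores have been computed. -/
inductive State {d : ℕ} [NeZero d] (n : Fin d → ℕ) (r : ℕ) where
  | start : State n r
  | eigen (E E' : Matrix (Fin (n 0)) (Fin r × Fin r) ℂ) : State n r
  | blocks (E : Matrix (Fin (n 0)) (Fin r × Fin r) ℂ)
      (F : Matrix (Fin r × Fin r) (Fin r × Fin r) ℂ) : State n r
  | gauge (E : Matrix (Fin (n 0)) (Fin r × Fin r) ℂ)
      (K : Fin r → Matrix (Fin r) (Fin r) ℂ) : State n r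
  | cores (m : ℕ) (Q : Cores n r) : State n r

/-- One step of the algorithm, whose only input is the family `obs` of observed entries and the
index choice. The step relation is not deterministic, as the eigenbases may be chosen freely. A
step that inverts a matrix is possible only if that matrix is invertible. -/
inductive Step {d r : ℕ} [NeZero d] [NeZero r] {n : Fin d → ℕ} (P : Choice n) (obs : P.Δ → ℂ) :
    State n r → State n r → Prop
  /-- Eigenvectors of `T(:,α,S) T(:,β,S)†` and `T(:,α',S') T(:,β',S')†`. -/
  | probes (X : Matrix P.S (Fin (n 0)) ℂ) (X' : Matrix P.S' (Fin (n 0)) ℂ)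
      (E E' : Matrix (Fin (n 0)) (Fin r × Fin r) ℂ)
      (hX : IsMoorePenrose (obsSlice obs P.β 0 (lastMode d) P.S) X)
      (hX' : IsMoorePenrose (obsSlice obs P.β' 0 (lastMode d) P.S') X')
      (hE : IsEigenbasis (obsSlice obs P.α 0 (lastMode d) P.S * X) E)
      (hE' : IsEigenbasis (obsSlice obs P.α' 0 (lastMode d) P.S' * X') E') :
      Step P obs .start (.eigen E E')
  /-- `F = E† E'`. -/
  | compare (E E' : Matrix (Fin (n 0)) (Fin r × Fin r) ℂ)
      (Y : Matrix (Fin r × Fin r) (Fin (n 0)) ℂ) (hY : IsMoorePenrose E Y) :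
      Step P obs (.eigen E E') (.blocks E (Y * E'))
  /-- `K_1 = I` and `K_ℓ = F^{(1,1)} (F^{(ℓ,1)})⁻¹` for the other `ℓ`. -/
  | fixGauge (E : Matrix (Fin (n 0)) (Fin r × Fin r) ℂ)
      (F : Matrix (Fin r × Fin r) (Fin r × Fin r) ℂ)
      (hF : ∀ l : Fin r, l ≠ 0 → IsUnit (subBlock F l 0)) :
      Step P obs (.blocks E F)
        (.gauge E fun l => if l = 0 then 1 else subBlock F 0 0 * (subBlock F l 0)⁻¹)
  /-- The first core: its unfolding is `E Π(K)⁻¹`. -/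
  | firstCore (E : Matrix (Fin (n 0)) (Fin r × Fin r) ℂ)
      (K : Fin r → Matrix (Fin r) (Fin r) ℂ)
      (hK : IsUnit (permPi (blockDiag K))) :
      Step P obs (.gauge E K)
        (.cores 1 (Function.update (0 : Cores n r) 0 (reshape (E * (permPi (blockDiag K))⁻¹))))
  /-- The core of mode `m + 1`, from those of the modes `0, …, m`. -/
  | nextCore (m : ℕ) (h : m + 1 < d) (Q : Cores n r)
      (Z : Matrix (P.G ⟨m, Nat.lt_of_succ_lt h⟩) (Fin r × Fin r) ℂ)
      (hZ : IsMoorePenrose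
        (((1 : Matrix (Fin r) (Fin r) ℂ) ⊗ₖ
            ((List.ofFn fun k : Fin d => coreSlice Q k (P.γ k)).take m).prod) *
          (unfoldBracket (Q ⟨m, Nat.lt_of_succ_lt h⟩)).transpose.submatrix id Subtype.val) Z) :
      Step P obs (.cores (m + 1) Q)
        (.cores (m + 2) (Function.update Q ⟨m + 1, h⟩
          (reshape (obsSlice obs P.γ ⟨m + 1, h⟩ ⟨m, Nat.lt_of_succ_lt h⟩
            (P.G ⟨m, Nat.lt_of_succ_lt h⟩) * Z))))

/-- `RunsTo P obs N s`: some run of the algorithm is in state `s` after `N` steps. -/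
inductive RunsTo {d r : ℕ} [NeZero d] [NeZero r] {n : Fin d → ℕ} (P : Choice n) (obs : P.Δ → ℂ) :
    ℕ → State n r → Prop
  | init : RunsTo P obs 0 .start
  | next {N : ℕ} {s t : State n r} : RunsTo P obs N s → Step P obs s t → RunsTo P obs (N + 1) t

end TensorRing

end

open TensorRing

open MeasureTheory
open scoped Kronecker

noncomputable section

/-! Count modes from 1, let `A` be the unfolding of the first core and `R^α` the product of the
middle slices selected by `α`. Then `T(:,α,S) = A (I ⊗ R^α) C` with `C` square and, generically,
invertible. Hence `T(:,α,S) T(:,β,S)† = A (I ⊗ M) B` with `B A = I` and `M = R^α (R^β)⁻¹`. If `U`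
diagonalizes `M`, every eigenbasis allowed in step 1 is `A` times a matrix with entries `U_{lk}
(P_k)_{ij}`, where the invertible `P_k` record the free choice inside the `k`-th eigenspace
(`IsEigenbasis.exists_probeFactor`).

The second probe has its own `U'` and `P'_k`, and `F = E† E'` satisfies `P_j F^{(j,k)} = (U⁻¹
U')_{jk} P'_k` (`mul_subBlock_of_probeFactor_mul`). If `U⁻¹ U'` has no zero entry, quotients of
blocks in the first block column give `P_1⁻¹ P_l` up to scalars. Dividing `E` by them removes the
ambiguity and leaves the first core in some gauge (`reshape_firstCore`).

Each later core solves an invertible linear system (`CoreInv.next`). The first core fixes `L_1` and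
`L_2`; the fixed index `γ` then forces `L_k = Q_k^{(γ_k)} ⋯ Q_d^{(γ_d)} L_1` for `k ≥ 3`. The empty
product at `k = d + 1` closes the ring (`CoreInv.gaugeEquiv`).

What is needed of the cores is a finite list of polynomial inequations, `IsGeneric`: nonzero minors,
invertible slices, simple spectrum of `M` (`traceGram`) and nonzero overlaps (`powProducts`). A
holomorphic function that is not identically zero has a null zero set, so one witness per condition
suffices. Admissibility enters in the witnesses for the last two: `exists_midQuot_rel` brings the
two quotients, up to order and inversion, to `X` and `V X V` with `V` an involution, and
`exists_transversalPair` supplies suitable `X` and `V`. -/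

namespace TensorRing

/-! ### Zero sets of holomorphic functions are null sets -/

section NullSets

/-- On a line through a point where it does not vanish, a holomorphic function vanishes only on a
null set. -/
theorem ae_ne_zero_on_line {E : Type*} [NormedAddCommGroup E] [NormedSpace ℂ E] [NormedSpace ℝ E]
    [IsScalarTower ℝ ℂ E] {f : E → ℂ} (hf : Differentiable ℂ f) {x₀ : E} (h₀ : f x₀ ≠ 0) (x : E) :
    ∀ᵐ t : ℝ, f (x₀ + t • x) ≠ 0 := by
  have hg : Differentiable ℂ fun z : ℂ => f (x₀ + z • x) := by fun_prop
  -- The restriction of an entire function to the real axis is real analytic; as it is nonzero at `t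
  -- = 0`, its zeros are discrete.
  have hA : AnalyticOnNhd ℝ (fun t : ℝ => f (x₀ + (t : ℂ) • x)) Set.univ := by
    intro t _
    have h1 : AnalyticAt ℝ (fun z : ℂ => f (x₀ + z • x)) (t : ℂ) :=
      (hg.analyticAt (t : ℂ)).restrictScalars
    exact h1.comp (Complex.ofRealCLM.analyticAt t)
  have h := hA.preimage_zero_mem_codiscrete (x := 0) (by simpa using h₀)
  have h' := ae_restrict_le_codiscreteWithin (μ := (volume : Measure ℝ)) MeasurableSet.univ h
  rw [Measure.restrict_univ] at h'
  filter_upwards [h'] with t ht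
  have hs : (t : ℂ) • x = t • x := algebraMap_smul ℂ t x
  rw [← hs]
  exact ht

/-- A holomorphic function on a finite-dimensional space that does not vanish identically is
nonzero almost everywhere. -/
theorem ae_ne_zero_of_differentiable {E : Type*} [NormedAddCommGroup E] [NormedSpace ℂ E]
    [NormedSpace ℝ E] [IsScalarTower ℝ ℂ E] [FiniteDimensional ℝ E] [MeasurableSpace E]
    [BorelSpace E] (μ : Measure E) [μ.IsAddHaarMeasure] {f : E → ℂ} (hf : Differentiable ℂ f)
    {x₀ : E} (h₀ : f x₀ ≠ 0) : ∀ᵐ x ∂μ, f x ≠ 0 := by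
  have := FiniteDimensional.proper_real E
  have : SecondCountableTopology E := secondCountable_of_proper
  have hm : MeasurableSet {p : E × ℝ | f (x₀ + p.2 • p.1) ≠ 0} := by
    have hc : Continuous fun p : E × ℝ => f (x₀ + p.2 • p.1) :=
      hf.continuous.comp (by fun_prop)
    exact (isOpen_ne_fun hc continuous_const).measurableSet
  have h1 : ∀ᵐ p ∂(μ.prod (volume : Measure ℝ)), f (x₀ + p.2 • p.1) ≠ 0 := by
    rw [Measure.ae_prod_iff_ae_ae hm]
    exact Filter.Eventually.of_forall fun x => ae_ne_zero_on_line hf h₀ x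
  have h2 : ∀ᵐ t : ℝ, ∀ᵐ x ∂μ, f (x₀ + t • x) ≠ 0 := by
    have h3 := (Measure.measurePreserving_swap (μ := (volume : Measure ℝ)) (ν := μ)
      ).quasiMeasurePreserving.ae h1
    exact Measure.ae_ae_of_ae_prod h3
  -- One nonzero `t` whose exceptional set is null is enough, because scaling by `t` and translating
  -- by `x₀` preserve null sets.
  obtain ⟨t, ht, ht0⟩ : ∃ t : ℝ, (∀ᵐ x ∂μ, f (x₀ + t • x) ≠ 0) ∧ t ≠ 0 := by
    have h4 : ∀ᵐ t : ℝ, t ≠ 0 := by simp [ae_iff]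
    exact (h2.and h4).exists
  have h5 : μ ((fun x => t • x) ⁻¹' {y | ¬ f (x₀ + y) ≠ 0}) = 0 := ht
  rw [Measure.addHaar_preimage_smul μ ht0] at h5
  have h6 : μ {y | ¬ f (x₀ + y) ≠ 0} = 0 := by
    rcases mul_eq_zero.1 h5 with h | h
    · exfalso
      have : 0 < |(t ^ Module.finrank ℝ E)⁻¹| := by positivity
      exact (ENNReal.ofReal_pos.2 this).ne' h
    · exact h
  have h7 : μ ((fun y => x₀ + y) ⁻¹' {y | ¬ f y ≠ 0}) = 0 := h6
  rwa [measure_preimage_add] at h7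

end NullSets

/-! ### Holomorphic matrix functions, handled entry by entry -/

section EntrywiseDifferentiable

variable {E : Type*} [NormedAddCommGroup E] [NormedSpace ℂ E]

/-- A matrix-valued function with holomorphic entries. -/
def EntryDifferentiable {m n : Type*} (M : E → Matrix m n ℂ) : Prop :=
  ∀ i j, Differentiable ℂ fun x => M x i j

namespace EntryDifferentiable

theorem const {m n : Type*} (A : Matrix m n ℂ) : EntryDifferentiable fun _ : E => A :=
  fun _ _ => differentiable_const _

theorem mul {l m n : Type*} [Fintype m] {M : E → Matrix l m ℂ} {N : E → Matrix m n ℂ}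
    (hM : EntryDifferentiable M) (hN : EntryDifferentiable N) :
    EntryDifferentiable fun x => M x * N x := by
  intro i j
  simp only [Matrix.mul_apply]
  exact Differentiable.fun_sum fun k _ => (hM i k).mul (hN k j)

theorem pow {m : Type*} [Fintype m] [DecidableEq m] {M : E → Matrix m m ℂ}
    (hM : EntryDifferentiable M) (k : ℕ) : EntryDifferentiable fun x => M x ^ k := by
  induction k with
  | zero => simpa using const (E := E) (1 : Matrix m m ℂ)
  | succ k ih => simpa only [pow_succ] using ih.mul hM

theorem listProd {m : Type*} [Fintype m] [DecidableEq m] (l : List (E → Matrix m m ℂ))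
    (h : ∀ M ∈ l, EntryDifferentiable M) :
    EntryDifferentiable fun x => (l.map fun M => M x).prod := by
  induction l with
  | nil => simpa using const (E := E) (1 : Matrix m m ℂ)
  | cons M l ih =>
    simp only [List.map_cons, List.prod_cons]
    exact (h M (by simp)).mul (ih fun N hN => h N (by simp [hN]))

theorem listOfFn_prod {m : Type*} [Fintype m] [DecidableEq m] {d : ℕ}
    {M : Fin d → E → Matrix m m ℂ} (h : ∀ k, EntryDifferentiable (M k)) :
    EntryDifferentiable fun x => (List.ofFn fun k => M k x).prod := by
  have := listProd (List.ofFn M) (by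
    intro N hN
    obtain ⟨k, rfl⟩ := (List.mem_ofFn' _ _).1 hN
    exact h k)
  simpa [List.map_ofFn, Function.comp_def] using this

theorem det {m : Type*} [Fintype m] [DecidableEq m] {M : E → Matrix m m ℂ}
    (hM : EntryDifferentiable M) : Differentiable ℂ fun x => (M x).det := by
  simp only [Matrix.det_apply, Units.smul_def, zsmul_eq_mul]
  refine Differentiable.fun_sum fun σ _ => (differentiable_const _).mul fun x => ?_
  exact (HasFDerivAt.finsetProd fun i _ => (hM (σ i) i x).hasFDerivAt).differentiableAt

theorem trace {m : Type*} [Fintype m] {M : E → Matrix m m ℂ}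
    (hM : EntryDifferentiable M) : Differentiable ℂ fun x => (M x).trace := by
  simp only [Matrix.trace, Matrix.diag]
  exact Differentiable.fun_sum fun i _ => hM i i

theorem adjugate {m : Type*} [Fintype m] [DecidableEq m] {M : E → Matrix m m ℂ}
    (hM : EntryDifferentiable M) : EntryDifferentiable fun x => (M x).adjugate := by
  intro i j
  simp only [Matrix.adjugate_apply]
  refine det fun k l => ?_
  by_cases hk : k = j
  · subst hk
    simp
  · simpa [Matrix.updateRow_ne hk] using hM k l

end EntryDifferentiable

end EntrywiseDifferentiable

/-! ### Simple spectrum and eigenvector overlaps as polynomial conditions -/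

section Spectrum

open scoped Matrix

variable {r : ℕ}

/-- The Gram matrix of the trace form on the powers of `N`. -/
def traceGram (N : Matrix (Fin r) (Fin r) ℂ) : Matrix (Fin r) (Fin r) ℂ :=
  Matrix.of fun a b => (N ^ (a.1 + b.1)).trace

/-- The matrix whose rows are the entries of the products `N ^ a * N' ^ b`. -/
def powProducts (N N' : Matrix (Fin r) (Fin r) ℂ) :
    Matrix (Fin r × Fin r) (Fin r × Fin r) ℂ :=
  Matrix.of fun ab ij => (N ^ ab.1.1 * N' ^ ab.2.1) ij.1 ij.2

theorem trace_aeval_mul_pow {N : Matrix (Fin r) (Fin r) ℂ} {p : Polynomial ℂ}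
    (hp : p.natDegree < r) (b : ℕ) :
    (Polynomial.aeval N p * N ^ b).trace = ∑ a : Fin r, p.coeff a * (N ^ (a.1 + b)).trace := by
  rw [Polynomial.aeval_eq_sum_range' hp, Finset.sum_mul, Matrix.trace_sum, Finset.sum_range]
  refine Finset.sum_congr rfl fun a _ => ?_
  rw [smul_mul_assoc, ← pow_add, Matrix.trace_smul, smul_eq_mul]

/-- The determinant is a discriminant. At a multiple root `z`, the polynomial `p = χ / (X - z)` has
`χ ∣ p²`, so `p(N)` is nilpotent, all traces of `p(N) N^b` vanish, and the coefficients of `p` lie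
in the kernel of the Gram matrix. -/
theorem nodup_roots_charpoly {N : Matrix (Fin r) (Fin r) ℂ} (h : (traceGram N).det ≠ 0) :
    N.charpoly.roots.Nodup := by
  rw [Multiset.nodup_iff_count_le_one]
  intro z
  by_contra! hz
  rw [Polynomial.count_roots] at hz
  have hχ : N.charpoly ≠ 0 := N.charpoly_monic.ne_zero
  obtain ⟨q, hq⟩ := (Polynomial.le_rootMultiplicity_iff hχ).1 (show 2 ≤ _ from hz)
  set p := (Polynomial.X - Polynomial.C z) * q with hp
  have hχp : N.charpoly = (Polynomial.X - Polynomial.C z) * p := by rw [hq, hp]; ring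
  have hp0 : p ≠ 0 := by
    rintro h0
    exact hχ (by rw [hχp, h0, mul_zero])
  have hdeg : p.natDegree < r := by
    have h1 := congrArg Polynomial.natDegree hχp
    rw [Polynomial.natDegree_mul (Polynomial.X_sub_C_ne_zero z) hp0,
      Polynomial.natDegree_X_sub_C, Matrix.charpoly_natDegree_eq_dim, Fintype.card_fin] at h1
    omega
  have hnil : IsNilpotent (Polynomial.aeval N p) := by
    refine ⟨2, ?_⟩
    have : p ^ 2 = N.charpoly * q := by rw [hχp, hp]; ring
    rw [← map_pow, this, map_mul, Matrix.aeval_self_charpoly, zero_mul]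
  have hker : (fun a : Fin r => p.coeff a) ᵥ* traceGram N = 0 := by
    funext b
    have h1 : (Polynomial.aeval N p * N ^ b.1).trace = 0 := by
      have hc : Commute (Polynomial.aeval N p) (N ^ b.1) := by
        have := (Commute.all p (Polynomial.X ^ b.1)).map (Polynomial.aeval N)
        simpa using this
      exact (Matrix.isNilpotent_trace_of_isNilpotent
        (hc.isNilpotent_mul_right hnil)).eq_zero
    rw [trace_aeval_mul_pow hdeg] at h1
    simpa [Matrix.vecMul, dotProduct, traceGram] using h1
  have hc0 := Matrix.eq_zero_of_vecMul_eq_zero h hker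
  apply hp0
  ext a
  by_cases ha : a < r
  · simpa using congrFun hc0 ⟨a, ha⟩
  · rw [Polynomial.coeff_eq_zero_of_natDegree_lt (by omega), Polynomial.coeff_zero]

/-- Eigenvectors for distinct eigenvalues form an invertible matrix. -/
theorem isUnit_of_eigenvectors {M : Matrix (Fin r) (Fin r) ℂ} {x : Fin r → ℂ}
    (hx : Function.Injective x) {u : Fin r → Fin r → ℂ} (hu : ∀ k, u k ≠ 0)
    (h : ∀ k, M.mulVec (u k) = x k • u k) :
    IsUnit (Matrix.of fun l k => u k l) := by
  have hli : LinearIndependent ℂ u := by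
    refine Module.End.eigenvectors_linearIndependent' (Matrix.toLin' M) x hx u fun k => ?_
    refine Module.End.hasEigenvector_iff.2 ⟨?_, hu k⟩
    rw [Module.End.mem_eigenspace_iff, Matrix.toLin'_apply, h k]
  rw [← Matrix.linearIndependent_cols_iff_isUnit]
  exact hli

theorem mul_eq_mul_diagonal {M : Matrix (Fin r) (Fin r) ℂ} {x : Fin r → ℂ}
    {u : Fin r → Fin r → ℂ} (h : ∀ k, M.mulVec (u k) = x k • u k) :
    M * (Matrix.of fun l k => u k l) = (Matrix.of fun l k => u k l) * Matrix.diagonal x := by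
  ext i k
  rw [Matrix.mul_diagonal]
  have := congrFun (h k) i
  simp only [Matrix.mulVec, dotProduct, Pi.smul_apply, smul_eq_mul] at this
  simp only [Matrix.mul_apply, Matrix.of_apply, this, mul_comm]

theorem exists_diagonalization {N : Matrix (Fin r) (Fin r) ℂ} (h : (traceGram N).det ≠ 0) :
    ∃ (x : Fin r → ℂ) (U : GL (Fin r) ℂ), Function.Injective x ∧
      N * U.val = U.val * Matrix.diagonal x := by
  have hcard : N.charpoly.roots.toFinset.card = r := by
    rw [Multiset.toFinset_card_of_nodup (nodup_roots_charpoly h),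
      IsAlgClosed.card_roots_eq_natDegree, Matrix.charpoly_natDegree_eq_dim, Fintype.card_fin]
  let e := (Finset.equivFinOfCardEq hcard).symm
  have hroot : ∀ k, ∃ v : Fin r → ℂ, v ≠ 0 ∧ N.mulVec v = (e k).1 • v := by
    intro k
    have h1 : N.charpoly.IsRoot (e k).1 :=
      (Polynomial.mem_roots'.1 (Multiset.mem_toFinset.1 (e k).2)).2
    rw [Polynomial.IsRoot, Matrix.eval_charpoly] at h1
    obtain ⟨v, hv, hv0⟩ := Matrix.exists_mulVec_eq_zero_iff.2 h1
    refine ⟨v, hv, ?_⟩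
    rw [Matrix.sub_mulVec, sub_eq_zero] at hv0
    rw [← hv0]
    ext i
    simp [Matrix.scalar_apply, Matrix.mulVec_diagonal]
  choose u hu0 hu using hroot
  have hinj : Function.Injective fun k => (e k).1 :=
    Subtype.val_injective.comp e.injective
  exact ⟨fun k => (e k).1, (isUnit_of_eigenvectors hinj hu0 hu).unit, hinj,
    mul_eq_mul_diagonal hu⟩

theorem pow_mul_eq_of_mul_eq {N U D : Matrix (Fin r) (Fin r) ℂ} (h : N * U = U * D) (k : ℕ) :
    N ^ k * U = U * D ^ k :=
  (SemiconjBy.pow_right (show SemiconjBy U D N from h.symm) k).eq.symm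

theorem traceGram_det_ne_zero {N : Matrix (Fin r) (Fin r) ℂ} {x : Fin r → ℂ}
    (hx : Function.Injective x) {U : GL (Fin r) ℂ}
    (h : N * U.val = U.val * Matrix.diagonal x) : (traceGram N).det ≠ 0 := by
  have htr : ∀ k, (N ^ k).trace = ∑ i, x i ^ k := by
    intro k
    have h1 : N ^ k = U.val * Matrix.diagonal x ^ k * U⁻¹.val := by
      rw [← pow_mul_eq_of_mul_eq h k, mul_assoc, ← Units.val_mul, mul_inv_cancel, Units.val_one,
        mul_one]
    rw [h1, Matrix.trace_mul_cycle, ← Units.val_mul, inv_mul_cancel, Units.val_one, one_mul,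
      Matrix.diagonal_pow, Matrix.trace_diagonal]
    rfl
  have hG : traceGram N = (Matrix.vandermonde x).transpose * Matrix.vandermonde x := by
    ext a b
    simp only [traceGram, Matrix.of_apply, htr, Matrix.mul_apply, Matrix.transpose_apply,
      Matrix.vandermonde_apply]
    simp only [pow_add]
  rw [hG, Matrix.det_mul, Matrix.det_transpose]
  exact mul_ne_zero (Matrix.det_vandermonde_ne_zero_iff.2 hx)
    (Matrix.det_vandermonde_ne_zero_iff.2 hx)

/-- Conjugating a linear relation between the `N^a N'^b` by the two eigenbases turns its `(j,k)`
entry into `(U⁻¹ U')_{jk} ∑ c_{ab} x_j^a x'_k^b`. Since the overlaps are nonzero, two Vandermonde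
matrices then annihilate `c`. -/
theorem powProducts_det_ne_zero {N N' : Matrix (Fin r) (Fin r) ℂ} {x x' : Fin r → ℂ}
    (hx : Function.Injective x) (hx' : Function.Injective x') {U U' : GL (Fin r) ℂ}
    (h : N * U.val = U.val * Matrix.diagonal x) (h' : N' * U'.val = U'.val * Matrix.diagonal x')
    (hV : ∀ i j, (U⁻¹ * U').val i j ≠ 0) : (powProducts N N').det ≠ 0 := by
  intro hdet
  obtain ⟨c, hc, hc0⟩ := Matrix.exists_vecMul_eq_zero_iff.2 hdet
  apply hc
  have hsum : ∑ ab : Fin r × Fin r, c ab • (N ^ ab.1.1 * N' ^ ab.2.1) = 0 := by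
    ext i j
    have := congrFun hc0 (i, j)
    simpa [Matrix.vecMul, dotProduct, powProducts, Matrix.sum_apply] using this
  have hprod : ∀ a b : ℕ, U⁻¹.val * (N ^ a * N' ^ b) * U'.val =
      Matrix.diagonal x ^ a * (U⁻¹ * U').val * Matrix.diagonal x' ^ b := by
    intro a b
    have h1 : U⁻¹.val * N ^ a = Matrix.diagonal x ^ a * U⁻¹.val := by
      have h2 := pow_mul_eq_of_mul_eq h a
      calc U⁻¹.val * N ^ a = U⁻¹.val * (N ^ a * U.val) * U⁻¹.val := by
            rw [mul_assoc, mul_assoc (N ^ a), ← Units.val_mul, mul_inv_cancel, Units.val_one,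
              mul_one]
        _ = Matrix.diagonal x ^ a * U⁻¹.val := by
            rw [h2, ← mul_assoc, ← Units.val_mul, inv_mul_cancel, Units.val_one, one_mul]
    rw [← mul_assoc, h1, mul_assoc, mul_assoc, pow_mul_eq_of_mul_eq h' b, Units.val_mul]
    simp only [mul_assoc]
  have hentry : Matrix.vandermonde x * (Matrix.of fun a b => c (a, b)) *
      (Matrix.vandermonde x').transpose = 0 := by
    ext j k
    have h1 := congrArg (fun Y => (U⁻¹.val * Y * U'.val) j k) hsum
    simp only [Finset.mul_sum, Finset.sum_mul, mul_smul_comm, smul_mul_assoc, hprod,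
      Matrix.diagonal_pow, mul_zero, zero_mul, Matrix.zero_apply, Matrix.sum_apply,
      Matrix.smul_apply, Matrix.mul_diagonal, Matrix.diagonal_mul, smul_eq_mul,
      Pi.pow_apply] at h1
    have h2 : (∑ ab : Fin r × Fin r, c ab * (x j ^ ab.1.1 * x' k ^ ab.2.1)) *
        (U⁻¹ * U').val j k = 0 := by
      rw [← h1, Finset.sum_mul]
      exact Finset.sum_congr rfl fun ab _ => by ring
    have h3 := (mul_eq_zero.1 h2).resolve_right (hV j k)
    rw [Fintype.sum_prod_type, Finset.sum_comm] at h3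
    simp only [Matrix.mul_apply, Matrix.vandermonde, Matrix.of_apply, Matrix.transpose_apply,
      Matrix.zero_apply, Finset.sum_mul]
    rw [← h3]
    exact Finset.sum_congr rfl fun b _ => Finset.sum_congr rfl fun a _ => by ring
  have hu : IsUnit (Matrix.vandermonde x) :=
    (Matrix.isUnit_iff_isUnit_det _).2 (Matrix.det_vandermonde_ne_zero_iff.2 hx).isUnit
  have hu' : IsUnit (Matrix.vandermonde x').transpose :=
    (Matrix.isUnit_iff_isUnit_det _).2 (by
      rw [Matrix.det_transpose]; exact (Matrix.det_vandermonde_ne_zero_iff.2 hx').isUnit)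
  rw [hu'.mul_left_eq_zero, hu.mul_right_eq_zero] at hentry
  funext ab
  exact congrFun (congrFun hentry ab.1) ab.2

/-- The products `N^a N'^b` span all matrices. If `w ⬝ v` were zero, then `w N^a N'^b v` would
vanish for all `a`, `b`, hence `w Y v = 0` for every matrix `Y`, which is impossible. -/
theorem dotProduct_ne_zero_of_eigenvectors {N N' : Matrix (Fin r) (Fin r) ℂ}
    (h : (powProducts N N').det ≠ 0) {w v : Fin r → ℂ} {z z' : ℂ} (hw : w ≠ 0) (hv : v ≠ 0)
    (hwN : w ᵥ* N = z • w) (hvN : N'.mulVec v = z' • v) : w ⬝ᵥ v ≠ 0 := by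
  intro h0
  have hwp : ∀ a : ℕ, w ᵥ* N ^ a = z ^ a • w := by
    intro a
    induction a with
    | zero => simp
    | succ a ih => rw [pow_succ, ← Matrix.vecMul_vecMul, ih, Matrix.smul_vecMul, hwN, smul_smul,
        pow_succ]
  have hvp : ∀ b : ℕ, (N' ^ b).mulVec v = z' ^ b • v := by
    intro b
    induction b with
    | zero => simp
    | succ b ih => rw [pow_succ, ← Matrix.mulVec_mulVec, hvN, Matrix.mulVec_smul, ih, smul_smul,
        pow_succ, mul_comm]
  have hker : (powProducts N N').mulVec (fun ij => w ij.1 * v ij.2) = 0 := by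
    funext ab
    have h1 : w ⬝ᵥ (N ^ ab.1.1 * N' ^ ab.2.1).mulVec v = 0 := by
      rw [← Matrix.mulVec_mulVec, Matrix.dotProduct_mulVec, hwp, hvp, smul_dotProduct,
        dotProduct_smul, h0]
      simp
    rw [Pi.zero_apply, ← h1]
    simp only [Matrix.mulVec, dotProduct, powProducts, Matrix.of_apply, Fintype.sum_prod_type,
      Finset.mul_sum]
    exact Finset.sum_congr rfl fun i _ => Finset.sum_congr rfl fun j _ => by ring
  have hz := Matrix.eq_zero_of_mulVec_eq_zero h hker
  obtain ⟨i, hi⟩ := Function.ne_iff.1 hw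
  obtain ⟨j, hj⟩ := Function.ne_iff.1 hv
  exact mul_ne_zero hi hj (congrFun hz (i, j))

end Spectrum

/-! ### Moore–Penrose inverses of matrices with a left inverse -/

section MoorePenrose

open scoped ComplexOrder

variable {p q : Type} [Fintype p] [Fintype q] [DecidableEq q]

theorem IsMoorePenrose.mul_eq_one {A : Matrix p q ℂ} {X : Matrix q p ℂ} (h : IsMoorePenrose A X)
    {B : Matrix q p ℂ} (hB : B * A = 1) : X * A = 1 := by
  have h1 := congrArg (B * ·) h.1
  simp only [hB] at h1
  rwa [Matrix.mul_assoc A, ← Matrix.mul_assoc B, hB, Matrix.one_mul] at h1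

theorem exists_isMoorePenrose {A : Matrix p q ℂ} {B : Matrix q p ℂ} (hB : B * A = 1) :
    ∃ X, IsMoorePenrose A X := by
  have hpd : (A.conjTranspose * A).PosDef := by
    refine Matrix.PosDef.conjTranspose_mul_self A ?_
    -- The left inverse makes `A` injective, so `Aᴴ A` is positive definite and `(Aᴴ A)⁻¹ Aᴴ` is
    -- available.
    intro u v huv
    have := congrArg B.mulVec huv
    simpa [Matrix.mulVec_mulVec, hB] using this
  have hu := hpd.isUnit
  rw [Matrix.isUnit_iff_isUnit_det] at hu
  have h1 : (A.conjTranspose * A)⁻¹ * A.conjTranspose * A = 1 := by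
    rw [Matrix.mul_assoc, Matrix.nonsing_inv_mul _ hu]
  refine ⟨(A.conjTranspose * A)⁻¹ * A.conjTranspose, ?_, ?_, ?_, ?_⟩
  · rw [Matrix.mul_assoc, h1, Matrix.mul_one]
  · rw [h1, Matrix.one_mul]
  · rw [Matrix.conjTranspose_mul, Matrix.conjTranspose_mul, Matrix.conjTranspose_conjTranspose,
      Matrix.conjTranspose_nonsing_inv, Matrix.conjTranspose_mul,
      Matrix.conjTranspose_conjTranspose, Matrix.mul_assoc]
  · rw [h1, Matrix.conjTranspose_one]

end MoorePenrose

/-! ### Prescribing two quotients of products in a group -/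

section MidProd

theorem take_ofFn_prod_succ {H : Type*} [Monoid H] {d : ℕ} (f : Fin d → H) {j : ℕ} (hj : j < d) :
    ((List.ofFn f).take (j + 1)).prod = ((List.ofFn f).take j).prod * f ⟨j, hj⟩ := by
  rw [List.prod_take_succ _ _ (by simpa using hj)]
  simp

theorem ofFn_prod_eq_take {H : Type*} [Monoid H] {d : ℕ} (f : Fin d → H) :
    (List.ofFn f).prod = ((List.ofFn f).take d).prod := by
  rw [List.take_of_length_le (by simp)]

theorem take_ofFn_prod_of_single {H : Type*} [Monoid H] {d : ℕ} {f : Fin d → H} {m : Fin d}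
    (hf : ∀ k, k ≠ m → f k = 1) {j : ℕ} (hj : j ≤ d) :
    ((List.ofFn f).take j).prod = if m.1 < j then f m else 1 := by
  induction j with
  | zero => simp
  | succ j ih =>
    rw [take_ofFn_prod_succ f hj, ih (by omega)]
    by_cases hjm : (⟨j, hj⟩ : Fin d) = m
    · subst hjm
      simp
    · have h1 : m.1 ≠ j := fun h => hjm (Fin.ext h.symm)
      rw [hf _ hjm, mul_one]
      exact if_congr (by omega) rfl rfl

theorem take_ofFn_prod_of_pair {H : Type*} [Monoid H] {d : ℕ} {f : Fin d → H} {p m : Fin d}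
    (hpm : p < m)
    (hf : ∀ k, k ≠ p → k ≠ m → f k = 1) {j : ℕ} (hj : j ≤ d) :
    ((List.ofFn f).take j).prod = (if p.1 < j then f p else 1) * if m.1 < j then f m else 1 := by
  induction j with
  | zero => simp
  | succ j ih =>
    rw [take_ofFn_prod_succ f hj, ih (by omega)]
    have hpm' : p.1 < m.1 := hpm
    by_cases hjm : (⟨j, hj⟩ : Fin d) = m
    · subst hjm
      have h1 : p.1 < j := hpm'
      simp [h1, Nat.lt_succ_of_lt h1]
    by_cases hjp : (⟨j, hj⟩ : Fin d) = p
    · subst hjp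
      have h1 : ¬ m.1 < j := by simp at hpm'; omega
      have h2 : ¬ m.1 < j + 1 := by simp at hpm'; omega
      simp [h1, h2]
    · have h1 : m.1 ≠ j := fun h => hjm (Fin.ext h.symm)
      have h2 : p.1 ≠ j := fun h => hjp (Fin.ext h.symm)
      rw [hf _ hjp hjm, mul_one]
      exact congrArg₂ _ (if_congr (by omega) rfl rfl) (if_congr (by omega) rfl rfl)

variable {d : ℕ} [NeZero d] {n : Fin d → ℕ}

open Classical in
/-- The ordered product of the factors in the middle modes. -/
def midProd {H : Type*} [Monoid H] (f : Fin d → H) : H :=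
  (List.ofFn fun k => if IsMid k then f k else 1).prod

theorem midProd_update {H : Type*} [Monoid H] {m : Fin d} (hm : IsMid m) (B : Fin (n m) → H)
    (x : Index n) :
    midProd (fun k => Function.update (fun (k : Fin d) (_ : Fin (n k)) => (1 : H)) m B k (x k)) =
      B (x m) := by
  rw [midProd, ofFn_prod_eq_take, take_ofFn_prod_of_single (m := m) _ le_rfl]
  · simp [hm]
  · intro k hk
    simp [Function.update_of_ne hk]

theorem midProd_update_update {H : Type*} [Monoid H] {p m : Fin d} (hp : IsMid p) (hm : IsMid m)
    (hpm : p < m) (A : Fin (n p) → H) (B : Fin (n m) → H) (x : Index n) :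
    midProd (fun k => Function.update (Function.update
      (fun (k : Fin d) (_ : Fin (n k)) => (1 : H)) m B) p A k (x k)) = A (x p) * B (x m) := by
  rw [midProd, ofFn_prod_eq_take, take_ofFn_prod_of_pair hpm _ le_rfl]
  · simp [hm, hp, Function.update_of_ne hpm.ne']
  · intro k hkp hkm
    simp [Function.update_of_ne hkp, Function.update_of_ne hkm]

/-- The quotient of two middle products, for group-valued slices. -/
def midQuot {H : Type*} [Group H] (q : (k : Fin d) → Fin (n k) → H) (x y : Index n) : H :=
  midProd (fun k => q k (x k)) * (midProd fun k => q k (y k))⁻¹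

theorem midQuot_inv {H : Type*} [Group H] (q : (k : Fin d) → Fin (n k) → H) (x y : Index n) :
    (midQuot q x y)⁻¹ = midQuot q y x := by
  simp [midQuot]

/-- Only modes `m` and `m'` carry nontrivial slices. Mode `m'` cancels from the first quotient
because `α` and `β` agree there; in the second it corrects whatever mode `m` has contributed. -/
theorem exists_midQuot_of_lt {H : Type*} [Group H] (X Y : H) {α β α' β' : Index n} {m m' : Fin d}
    (hm : IsLastDiff α β m) (hm' : IsLastDiff α' β' m') (hlt : m < m') :
    ∃ q : (k : Fin d) → Fin (n k) → H, midQuot q α β = X ∧ midQuot q α' β' = Y := by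
  let A : Fin (n m) → H := fun a => if a = α m then X else 1
  let B : Fin (n m') → H := fun b => if b = α' m' then (A (α' m))⁻¹ * Y * A (β' m) else 1
  refine ⟨Function.update (Function.update (fun _ _ => 1) m' B) m A, ?_, ?_⟩ <;>
    simp only [midQuot, midProd_update_update hm.1 hm'.1 hlt]
  · rw [hm.2.2 m' hm'.1 hlt]
    simp [A, hm.2.1.symm, mul_assoc]
  · simp [B, hm'.2.1.symm, mul_assoc]

theorem exists_midQuot_of_not_mem {H : Type*} [Group H] (X Y : H) {α β α' β' : Index n}
    {m : Fin d} (hm : IsLastDiff α β m) (hm' : IsLastDiff α' β' m) (h₁ : α' m ≠ α m)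
    (h₂ : α' m ≠ β m) :
    ∃ q : (k : Fin d) → Fin (n k) → H, midQuot q α β = X ∧ midQuot q α' β' = Y := by
  let c : Fin (n m) → H := fun a => if a = α m then X else 1
  let B : Fin (n m) → H := fun a => if a = α' m then Y * c (β' m) else c a
  refine ⟨Function.update (fun _ _ => 1) m B, ?_, ?_⟩ <;>
    simp only [midQuot, midProd_update hm.1]
  · simp [B, c, h₁.symm, h₂.symm, hm.2.1.symm]
  · simp [B, hm'.2.1.symm]

/-- Mode `m` no longer separates the pairs, so an earlier mode `p` has to. With nontrivial slices
only in `p` and `m`, the quotients are `A(α p) Z A(β p)⁻¹` and `A(α' p) Z A(β' p)⁻¹`, and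
coincidences among the four arguments restrict them: when `β p = α p` and `β' p = α' p` they are
conjugate. This is why the second target is a conjugate of `X`; since `V` is an involution, `V X V`
also serves the crossed coincidence. -/
theorem exists_midQuot_of_agree {H : Type*} [Group H] (X V : H) (hV : V * V = 1)
    {α β α' β' : Index n} {p m : Fin d} (hp : IsMid p) (hpm : p < m) (hm : IsLastDiff α β m)
    (hα : α' m = α m) (hβ : β' m = β m) (hne : α p ≠ α' p) :
    ∃ q : (k : Fin d) → Fin (n k) → H, midQuot q α β = X ∧ midQuot q α' β' = V * X * V := by
  have hVi : V⁻¹ = V := inv_eq_of_mul_eq_one_left hV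
  have key : ∀ (A : Fin (n p) → H) (Z : H), A (α p) * Z * (A (β p))⁻¹ = X →
      A (α' p) * Z * (A (β' p))⁻¹ = V * X * V →
      ∃ q : (k : Fin d) → Fin (n k) → H,
        midQuot q α β = X ∧ midQuot q α' β' = V * X * V := by
    intro A Z h1 h2
    refine ⟨Function.update (Function.update (fun _ _ => 1) m
      fun b => if b = α m then Z else 1) p A, ?_, ?_⟩ <;>
    simp only [midQuot, midProd_update_update hp hm.1 hpm]
    · rw [← h1]
      simp [hm.2.1.symm]
    · rw [← h2]
      simp [hα, hβ, hm.2.1.symm]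
  -- If `α' p` or `α p` occurs only once among the four arguments, its slice can be adjusted freely.
  -- Otherwise the pairs are parallel (`β p = α p`, `β' p = α' p`) or crossed (`β p = α' p`, `β' p =
  -- α p`).
  by_cases h1 : β' p ≠ α' p ∧ β p ≠ α' p
  · refine key (fun a => if a = α' p then V * X * V * X⁻¹ else 1) X ?_ ?_
    · simp [hne, h1.2]
    · simp [h1.1]
  by_cases h2 : β' p ≠ α p ∧ β p ≠ α p
  · refine key (fun a => if a = α p then X * (V * X * V)⁻¹ else 1) (V * X * V) ?_ ?_
    · simp [h2.2, -mul_inv_rev]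
    · simp [h2.1, hne.symm]
  rcases (by tauto : β' p = α' p ∨ β p = α' p) with h3 | h3
  · have h4 : β p = α p := by
      by_contra h
      exact h2 ⟨by rw [h3]; exact hne.symm, h⟩
    refine key (fun a => if a = α' p then V else 1) X ?_ ?_
    · simp [h4, hne]
    · simp [h3, hVi]
  · have h4 : β' p = α p := by
      by_contra h
      exact h2 ⟨h, by rw [h3]; exact hne.symm⟩
    refine key (fun a => if a = α' p then V else 1) (X * V) ?_ ?_
    · simp [h3, hne]
    · simp [h4, hne, mul_assoc]

/-- For admissible probe pairs the two quotients of middle products can be brought into a given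
position relative to each other. -/
theorem exists_midQuot_rel {H : Type*} [Group H] {Rel : H → H → Prop}
    (hsymm : ∀ a b, Rel a b → Rel b a) (hinv : ∀ a b, Rel a b → Rel a⁻¹ b) {X V : H}
    (hV : V * V = 1) (hXV : Rel X (V * X * V)) {α β α' β' : Index n} {m m' : Fin d}
    (hm : IsLastDiff α β m) (hm' : IsLastDiff α' β' m')
    (hne : m = m' → ¬ (AgreeUpTo m α α' ∧ AgreeUpTo m β β') ∧
      ¬ (AgreeUpTo m α β' ∧ AgreeUpTo m β α')) :
    ∃ q : (k : Fin d) → Fin (n k) → H, Rel (midQuot q α β) (midQuot q α' β') := by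
  -- Swapping the members of a pair inverts its quotient, so symmetry and inversion invariance of
  -- `Rel` allow both the order of the pairs and the order inside a pair to be normalized.
  have hinv' : ∀ a b, Rel a b → Rel a b⁻¹ := fun a b h => hsymm _ _ (hinv _ _ (hsymm _ _ h))
  have of_pair : ∀ {x y x' y' : Index n}, (∃ q : (k : Fin d) → Fin (n k) → H,
      midQuot q x y = X ∧ midQuot q x' y' = V * X * V) →
      ∃ q : (k : Fin d) → Fin (n k) → H, Rel (midQuot q x y) (midQuot q x' y') := by
    rintro x y x' y' ⟨q, h1, h2⟩
    exact ⟨q, by rw [h1, h2]; exact hXV⟩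
  have flip_right : ∀ {x y x' y' : Index n},
      (∃ q : (k : Fin d) → Fin (n k) → H, Rel (midQuot q x y) (midQuot q x' y')) →
      ∃ q : (k : Fin d) → Fin (n k) → H, Rel (midQuot q x y) (midQuot q y' x') := by
    rintro x y x' y' ⟨q, h⟩
    exact ⟨q, by rw [← midQuot_inv q x' y']; exact hinv' _ _ h⟩
  have flip_both : ∀ {x y x' y' : Index n},
      (∃ q : (k : Fin d) → Fin (n k) → H, Rel (midQuot q x y) (midQuot q x' y')) →
      ∃ q : (k : Fin d) → Fin (n k) → H, Rel (midQuot q y x) (midQuot q y' x') := by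
    rintro x y x' y' ⟨q, h⟩
    exact ⟨q, by
      rw [← midQuot_inv q x' y', ← midQuot_inv q x y]; exact hinv _ _ (hinv' _ _ h)⟩
  have flip_diff : ∀ {x y : Index n} {m : Fin d}, IsLastDiff x y m → IsLastDiff y x m :=
    fun h => ⟨h.1, h.2.1.symm, fun k hk hmk => (h.2.2 k hk hmk).symm⟩
  have of_agree : ∀ {x' y' : Index n}, x' m = α m → y' m = β m →
      ¬ (AgreeUpTo m α x' ∧ AgreeUpTo m β y') →
      ∃ q : (k : Fin d) → Fin (n k) → H, Rel (midQuot q α β) (midQuot q x' y') := by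
    intro x' y' hx hy h
    rw [not_and_or] at h
    rcases h with h | h
    · simp only [AgreeUpTo, not_forall] at h
      obtain ⟨p, hp, hpm, hpne⟩ := h
      have hlt : p < m := lt_of_le_of_ne hpm (by rintro rfl; exact hpne hx.symm)
      exact of_pair (exists_midQuot_of_agree X V hV hp hlt hm hx hy hpne)
    · simp only [AgreeUpTo, not_forall] at h
      obtain ⟨p, hp, hpm, hpne⟩ := h
      have hlt : p < m := lt_of_le_of_ne hpm (by rintro rfl; exact hpne hy.symm)
      exact flip_both (of_pair
        (exists_midQuot_of_agree X V hV hp hlt (flip_diff hm) hy hx hpne))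
  rcases lt_trichotomy m m' with hlt | rfl | hlt
  · exact of_pair (exists_midQuot_of_lt X (V * X * V) hm hm' hlt)
  · obtain ⟨hne₁, hne₂⟩ := hne rfl
    by_cases h1 : α' m ≠ α m ∧ α' m ≠ β m
    · exact of_pair (exists_midQuot_of_not_mem _ _ hm hm' h1.1 h1.2)
    by_cases h2 : β' m ≠ α m ∧ β' m ≠ β m
    · exact flip_right (of_pair
        (exists_midQuot_of_not_mem _ _ hm (flip_diff hm') h2.1 h2.2))
    have hab := hm.2.1
    have hab' := hm'.2.1
    rcases (by tauto : α' m = α m ∨ α' m = β m) with h3 | h3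
    · have h4 : β' m = β m := by
        by_contra h
        exact h2 ⟨fun h' => hab' (h3.trans h'.symm), h⟩
      exact of_agree h3 h4 hne₁
    · have h4 : β' m = α m := by
        by_contra h
        exact h2 ⟨h, fun h' => hab' (h3.trans h'.symm)⟩
      exact flip_right (of_agree h4 h3 hne₂)
  · obtain ⟨q, h1, h2⟩ := exists_midQuot_of_lt X (V * X * V) hm' hm hlt
    exact ⟨q, hsymm _ _ (by rw [h1, h2]; exact hXV)⟩

end MidProd

/-! ### A pair of matrices in general position -/

section TransversalPair

variable {r : ℕ}

/-- Two invertible matrices with simple spectrum, no eigenvector of either of which lies in the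
span of `r - 1` eigenvectors of the other. -/
def TransversalPair (M M' : GL (Fin r) ℂ) : Prop :=
  ∃ (U U' : GL (Fin r) ℂ) (x x' : Fin r → ℂ), Function.Injective x ∧ Function.Injective x' ∧
    (∀ i, x i ≠ 0) ∧ (∀ i, x' i ≠ 0) ∧
    M.val * U.val = U.val * Matrix.diagonal x ∧ M'.val * U'.val = U'.val * Matrix.diagonal x' ∧
    (∀ i j, (U⁻¹ * U').val i j ≠ 0) ∧ ∀ i j, (U'⁻¹ * U).val i j ≠ 0

theorem TransversalPair.symm {M M' : GL (Fin r) ℂ} (h : TransversalPair M M') :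
    TransversalPair M' M := by
  obtain ⟨U, U', x, x', h1, h2, h3, h4, h5, h6, h7, h8⟩ := h
  exact ⟨U', U, x', x, h2, h1, h4, h3, h6, h5, h8, h7⟩

theorem TransversalPair.inv_left {M M' : GL (Fin r) ℂ} (h : TransversalPair M M') :
    TransversalPair M⁻¹ M' := by
  obtain ⟨U, U', x, x', h1, h2, h3, h4, h5, h6, h7, h8⟩ := h
  refine ⟨U, U', fun i => (x i)⁻¹, x', inv_injective.comp h1, h2, fun i => inv_ne_zero (h3 i), h4,
    ?_, h6, h7, h8⟩
  have hd : Matrix.diagonal x * Matrix.diagonal (fun i => (x i)⁻¹) = 1 := by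
    rw [Matrix.diagonal_mul_diagonal]
    simp [h3]
  have hMU : U.val = M⁻¹.val * (U.val * Matrix.diagonal x) := by
    rw [← h5, ← mul_assoc, ← Units.val_mul, inv_mul_cancel, Units.val_one, one_mul]
  conv_rhs => rw [hMU]
  rw [mul_assoc, mul_assoc, hd, mul_one]

/-- An involution without zero entries. -/
def fullInvolution (r : ℕ) [NeZero r] : Matrix (Fin r) (Fin r) ℂ :=
  1 - Matrix.of fun _ j => if j = 0 then 2 * (r : ℂ) else -2

theorem fullInvolution_mul_self (r : ℕ) [NeZero r] :
    fullInvolution r * fullInvolution r = 1 := by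
  set J : Matrix (Fin r) (Fin r) ℂ := Matrix.of fun _ j => if j = 0 then 2 * (r : ℂ) else -2
    with hJ
  -- All rows of `J` equal `(2r, -2, …, -2)`, whose sum is `2`; hence `J² = 2J` and `(1 - J)² = 1`.
  have hJJ : J * J = 2 • J := by
    ext i j
    have hs : ∑ k : Fin r, (if k = 0 then 2 * (r : ℂ) else -2) = 2 := by
      have : ∀ k : Fin r, (if k = 0 then 2 * (r : ℂ) else -2) =
          -2 + if k = 0 then 2 * (r : ℂ) + 2 else 0 := by
        intro k
        split_ifs <;> ring
      simp only [this, Finset.sum_add_distrib, Finset.sum_ite_eq', Finset.mem_univ, if_true,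
        Finset.sum_const, Finset.card_univ, Fintype.card_fin, nsmul_eq_mul]
      ring
    simp only [hJ, Matrix.mul_apply, Matrix.of_apply, Matrix.smul_apply, nsmul_eq_mul,
      ← Finset.sum_mul, hs, Nat.cast_ofNat]
  change (1 - J) * (1 - J) = 1
  simp only [sub_mul, mul_sub, one_mul, mul_one, hJJ, two_smul]
  simp

theorem fullInvolution_apply_ne_zero (r : ℕ) [NeZero r] (i j : Fin r) :
    fullInvolution r i j ≠ 0 := by
  simp only [fullInvolution, Matrix.sub_apply, Matrix.of_apply, Matrix.one_apply]
  intro h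
  have hr : (r : ℂ) ≠ 0 := Nat.cast_ne_zero.2 (NeZero.ne r)
  have hr2 : (2 * r : ℂ) ≠ 1 := by
    intro h1
    have : 2 * r = 1 := by exact_mod_cast h1
    omega
  split_ifs at h
  · exact hr2 (by linear_combination -h)
  · norm_num at h
  · exact hr (by linear_combination -h / 2)
  · norm_num at h

theorem exists_transversalPair (r : ℕ) [NeZero r] :
    ∃ X V : GL (Fin r) ℂ, V * V = 1 ∧ TransversalPair X (V * X * V) := by
  let x : Fin r → ℂ := fun i => (i.1 : ℂ) + 1
  have hx0 : ∀ i, x i ≠ 0 := fun i => Nat.cast_add_one_ne_zero i.1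
  have hx : Function.Injective x := fun i j h => by
    have : (i.1 : ℂ) = j.1 := add_right_cancel h
    exact Fin.ext (by exact_mod_cast this)
  let X : GL (Fin r) ℂ := ⟨Matrix.diagonal x, Matrix.diagonal fun i => (x i)⁻¹,
    by rw [Matrix.diagonal_mul_diagonal]; simp [hx0],
    by rw [Matrix.diagonal_mul_diagonal]; simp [hx0]⟩
  let V : GL (Fin r) ℂ := ⟨fullInvolution r, fullInvolution r, fullInvolution_mul_self r,
    fullInvolution_mul_self r⟩
  have hVV : V * V = 1 := Units.ext (fullInvolution_mul_self r)
  have hVi : V⁻¹ = V := rfl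
  -- With `X` diagonal, its eigenvector matrix is `1` and that of `V X V` is `V`, so both overlap
  -- matrices equal `V`, which has no zero entry.
  refine ⟨X, V, hVV, 1, V, x, x, hx, hx, hx0, hx0, ?_, ?_, ?_, ?_⟩
  · simp [X]
  · rw [← Units.val_mul, mul_assoc, hVV, mul_one, Units.val_mul]
  · simpa using fullInvolution_apply_ne_zero r
  · simpa [hVi] using fullInvolution_apply_ne_zero r

end TransversalPair

/-! ### Almost all cores are generic -/

section Generic

theorem isAddHaarMeasure_volume_pi {ι : Type} [Fintype ι] {G : ι → Type}
    [∀ i, NormedAddCommGroup (G i)] [∀ i, MeasureSpace (G i)] [∀ i, BorelSpace (G i)]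
    [∀ i, SecondCountableTopology (G i)] [∀ i, SigmaFinite (volume : Measure (G i))]
    [∀ i, Measure.IsAddHaarMeasure (volume : Measure (G i))] :
    (volume : Measure (∀ i, G i)).IsAddHaarMeasure :=
  Measure.pi.isAddHaarMeasure _

instance isAddHaarMeasure_volume_cores {d r : ℕ} {n : Fin d → ℕ} :
    (volume : Measure (Cores n r)).IsAddHaarMeasure := by
  have h1 : (volume : Measure (Fin r → Fin r → ℂ)).IsAddHaarMeasure := isAddHaarMeasure_volume_pi
  have h2 : ∀ k, (volume : Measure (Fin (n k) → Fin r → Fin r → ℂ)).IsAddHaarMeasure :=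
    fun k => isAddHaarMeasure_volume_pi
  have h3 : ∀ k, SigmaFinite (volume : Measure (Fin (n k) → Fin r → Fin r → ℂ)) :=
    fun k => Measure.pi.sigmaFinite _
  exact isAddHaarMeasure_volume_pi

theorem differentiable_coreSlice {d r : ℕ} {n : Fin d → ℕ} (k : Fin d) (a : Fin (n k)) :
    EntryDifferentiable fun Q : Cores n r => coreSlice Q k a := by
  intro i j
  change Differentiable ℂ fun Q : Cores n r => Q k a i j
  fun_prop

variable {d r : ℕ} [NeZero d] {n : Fin d → ℕ}

/-- The part of admissibility that concerns the two probe pairs. -/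
def ProbesDiffer (α β α' β' : Index n) : Prop :=
  ∃ m m' : Fin d, IsLastDiff α β m ∧ IsLastDiff α' β' m' ∧
    (m = m' → ¬ (AgreeUpTo m α α' ∧ AgreeUpTo m β β') ∧
      ¬ (AgreeUpTo m α β' ∧ AgreeUpTo m β α'))

/-- The condition on `traceGram` in `IsGeneric` mentions only the first pair; this symmetry makes it
apply to the second one. -/
theorem ProbesDiffer.swap {α β α' β' : Index n} (h : ProbesDiffer α β α' β') :
    ProbesDiffer α' β' α β := by
  obtain ⟨m, m', h1, h2, h3⟩ := h
  have hs : ∀ {k : Fin d} {x y : Index n}, AgreeUpTo k x y → AgreeUpTo k y x :=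
    fun h j hj hjk => (h j hj hjk).symm
  refine ⟨m', m, h2, h1, ?_⟩
  rintro rfl
  exact ⟨fun h => (h3 rfl).1 ⟨hs h.1, hs h.2⟩, fun h => (h3 rfl).2 ⟨hs h.2, hs h.1⟩⟩

/-- The product of the slices that `x` selects in the middle modes. -/
def midSlices (Q : Cores n r) (x : Index n) : Matrix (Fin r) (Fin r) ℂ :=
  midProd fun k => coreSlice Q k (x k)

/-- A scalar multiple of `R^α (R^β)⁻¹` that is a polynomial in the cores. -/
def probeMatrix (Q : Cores n r) (x y : Index n) : Matrix (Fin r) (Fin r) ℂ :=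
  midSlices Q x * (midSlices Q y).adjugate

theorem differentiable_midSlices (x : Index n) :
    EntryDifferentiable fun Q : Cores n r => midSlices Q x := by
  classical
  refine EntryDifferentiable.listOfFn_prod
    (M := fun k (Q : Cores n r) => if IsMid k then coreSlice Q k (x k) else 1) fun k => ?_
  by_cases hk : IsMid k
  · simpa [hk] using differentiable_coreSlice k (x k)
  · simpa [hk] using EntryDifferentiable.const (1 : Matrix (Fin r) (Fin r) ℂ)

theorem differentiable_probeMatrix (x y : Index n) :
    EntryDifferentiable fun Q : Cores n r => probeMatrix Q x y :=
  (differentiable_midSlices x).mul (differentiable_midSlices y).adjugate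

/-- The genericity conditions that the algorithm relies on. -/
structure IsGeneric (Q : Cores n r) : Prop where
  minor_ne_zero : ∀ (k : Fin d) (e : Fin r × Fin r ↪ Fin (n k)),
    ((unfoldAngle (Q k)).submatrix e id).det ≠ 0
  slice_ne_zero : ∀ (k : Fin d) (a : Fin (n k)), (coreSlice Q k a).det ≠ 0
  traceGram_ne_zero : ∀ α β α' β' : Index n, ProbesDiffer α β α' β' →
    (traceGram (probeMatrix Q α β)).det ≠ 0
  powProducts_ne_zero : ∀ α β α' β' : Index n, ProbesDiffer α β α' β' →
    (powProducts (probeMatrix Q α β) (probeMatrix Q α' β')).det ≠ 0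

theorem midSlices_of_units (q : (k : Fin d) → Fin (n k) → GL (Fin r) ℂ) (x : Index n) :
    midSlices (fun k a i j => (q k a).val i j) x = (midProd fun k => q k (x k)).val := by
  classical
  rw [midSlices, midProd, midProd, ← Units.coeHom_apply, map_list_prod, List.map_ofFn]
  congr 2
  funext k
  by_cases hk : IsMid k
  · simp only [hk, if_true, Function.comp_apply]
    rfl
  · simp [hk]

theorem probeMatrix_of_units (q : (k : Fin d) → Fin (n k) → GL (Fin r) ℂ) (x y : Index n) :
    ∃ c : ℂ, c ≠ 0 ∧
      probeMatrix (fun k a i j => (q k a).val i j) x y = c • (midQuot q x y).val := by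
  set R := midProd fun k => q k (y k) with hR
  have hdet : R.val.det ≠ 0 := ((Matrix.isUnit_iff_isUnit_det _).1 R.isUnit).ne_zero
  refine ⟨R.val.det, hdet, ?_⟩
  have hadj : R.val.adjugate = R.val.det • R⁻¹.val := by
    calc R.val.adjugate = R.val.adjugate * (R.val * R⁻¹.val) := by
          rw [← Units.val_mul, mul_inv_cancel, Units.val_one, mul_one]
      _ = R.val.det • R⁻¹.val := by
          rw [← mul_assoc, Matrix.adjugate_mul, smul_mul_assoc, one_mul]
  rw [probeMatrix, midSlices_of_units, midSlices_of_units, ← hR, hadj, mul_smul_comm, midQuot,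
    Units.val_mul]

/-- The witness has invertible slices, chosen in the group `GL` so that the two quotients are
transversal. The adjugate rescales each quotient by a nonzero scalar, which only rescales its
eigenvalues. -/
theorem exists_cores_of_probesDiffer [NeZero r] {α β α' β' : Index n}
    (h : ProbesDiffer α β α' β') :
    ∃ Q : Cores n r, (traceGram (probeMatrix Q α β)).det ≠ 0 ∧
      (powProducts (probeMatrix Q α β) (probeMatrix Q α' β')).det ≠ 0 := by
  obtain ⟨X, V, hV, hXV⟩ := exists_transversalPair r
  obtain ⟨m, m', hm, hm', hne⟩ := h
  obtain ⟨q, U, U', x, x', h1, h2, -, -, h5, h6, h7, -⟩ :=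
    exists_midQuot_rel (Rel := TransversalPair) (fun _ _ h => h.symm) (fun _ _ h => h.inv_left) hV
      hXV hm hm' hne
  obtain ⟨c, hc, hN⟩ := probeMatrix_of_units q α β
  obtain ⟨c', hc', hN'⟩ := probeMatrix_of_units q α' β'
  have hscale : ∀ {c : ℂ} {M U : Matrix (Fin r) (Fin r) ℂ} {x : Fin r → ℂ},
      M * U = U * Matrix.diagonal x → c • M * U = U * Matrix.diagonal (c • x) := by
    intro c M U x h
    rw [smul_mul_assoc, h, Matrix.diagonal_smul, mul_smul_comm]
  have hinj : ∀ {c : ℂ} {x : Fin r → ℂ}, c ≠ 0 → Function.Injective x →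
      Function.Injective (c • x) :=
    fun hc hx => (mul_right_injective₀ hc).comp hx
  refine ⟨fun k a i j => (q k a).val i j, ?_, ?_⟩ <;> rw [hN]
  · exact traceGram_det_ne_zero (hinj hc h1) (hscale h5)
  · rw [hN']
    exact powProducts_det_ne_zero (hinj hc h1) (hinj hc' h2) (hscale h5) (hscale h6) h7

theorem ae_isGeneric [NeZero r] : ∀ᵐ Q : Cores n r, IsGeneric Q := by
  have h1 : ∀ᵐ Q : Cores n r, ∀ (k : Fin d) (e : Fin r × Fin r ↪ Fin (n k)),
      ((unfoldAngle (Q k)).submatrix e id).det ≠ 0 := by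
    simp only [ae_all_iff]
    intro k e
    refine ae_ne_zero_of_differentiable volume (EntryDifferentiable.det fun x y => ?_)
      -- The rows selected by `e` are made the standard basis vectors, so that the minor is the
      -- identity matrix.
      (x₀ := Function.update (0 : Cores n r) k fun a i j => if a = e (i, j) then 1 else 0) ?_
    · change Differentiable ℂ fun Q : Cores n r => Q k (e x) y.1 y.2
      fun_prop
    · have : (unfoldAngle (Function.update (0 : Cores n r) k
          (fun a i j => if a = e (i, j) then 1 else 0) k)).submatrix e id = 1 := by
        ext x y
        simp [unfoldAngle, Matrix.one_apply]
      rw [this, Matrix.det_one]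
      exact one_ne_zero
  have h2 : ∀ᵐ Q : Cores n r, ∀ (k : Fin d) (a : Fin (n k)), (coreSlice Q k a).det ≠ 0 := by
    simp only [ae_all_iff]
    intro k a
    refine ae_ne_zero_of_differentiable volume (differentiable_coreSlice k a).det
      (x₀ := fun _ _ i j => (1 : Matrix (Fin r) (Fin r) ℂ) i j) ?_
    have : coreSlice (fun _ _ i j => (1 : Matrix (Fin r) (Fin r) ℂ) i j : Cores n r) k a = 1 := rfl
    rw [this, Matrix.det_one]
    exact one_ne_zero
  have h3 : ∀ᵐ Q : Cores n r, ∀ α β α' β' : Index n, ProbesDiffer α β α' β' →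
      (traceGram (probeMatrix Q α β)).det ≠ 0 := by
    simp only [ae_all_iff]
    intro α β α' β' h
    obtain ⟨Q₀, h0, -⟩ := exists_cores_of_probesDiffer (r := r) h
    exact ae_ne_zero_of_differentiable volume (EntryDifferentiable.det fun a b =>
      ((differentiable_probeMatrix α β).pow (a.1 + b.1)).trace) h0
  have h4 : ∀ᵐ Q : Cores n r, ∀ α β α' β' : Index n, ProbesDiffer α β α' β' →
      (powProducts (probeMatrix Q α β) (probeMatrix Q α' β')).det ≠ 0 := by
    simp only [ae_all_iff]
    intro α β α' β' h
    obtain ⟨Q₀, -, h0⟩ := exists_cores_of_probesDiffer (r := r) h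
    exact ae_ne_zero_of_differentiable volume (EntryDifferentiable.det fun ab ij =>
      (((differentiable_probeMatrix α β).pow ab.1.1).mul
        ((differentiable_probeMatrix α' β').pow ab.2.1)) ij.1 ij.2) h0
  filter_upwards [h1, h2, h3, h4] with Q g1 g2 g3 g4
  exact ⟨g1, g2, g3, g4⟩

end Generic

/-! ### Eigenbases of a probe, comparison of two probes, and the first core -/

section Probe

open scoped Matrix

variable {m r : ℕ}

/-- The coefficients of an eigenbasis of `A (I ⊗ M) A⁺` with respect to the columns of `A`, where
the columns of `U` are eigenvectors of `M` and `P k` is the change of basis in the eigenspace of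
the `k`-th eigenvalue. -/
def probeFactor (U : Matrix (Fin r) (Fin r) ℂ) (P : Fin r → Matrix (Fin r) (Fin r) ℂ) :
    Matrix (Fin r × Fin r) (Fin r × Fin r) ℂ :=
  Matrix.of fun x y => U x.2 y.2 * P y.2 x.1 y.1

theorem forall_mulVec_col_iff {A : Matrix (Fin m) (Fin m) ℂ}
    {E : Matrix (Fin m) (Fin r × Fin r) ℂ} {lam : Fin r → ℂ} :
    (∀ j k, A.mulVec (E.col (j, k)) = lam k • E.col (j, k)) ↔
      A * E = E * Matrix.diagonal fun y : Fin r × Fin r => lam y.2 := by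
  constructor
  · intro h
    ext i y
    rw [Matrix.mul_diagonal, mul_comm]
    exact congrFun (h y.1 y.2) i
  · intro h j k
    funext i
    have := congrFun (congrFun h i) (j, k)
    rw [Matrix.mul_diagonal, mul_comm] at this
    exact this

theorem one_kronecker_mul (M N : Matrix (Fin r) (Fin r) ℂ) :
    ((1 : Matrix (Fin r) (Fin r) ℂ) ⊗ₖ M) * ((1 : Matrix (Fin r) (Fin r) ℂ) ⊗ₖ N) =
      (1 : Matrix (Fin r) (Fin r) ℂ) ⊗ₖ (M * N) := by
  rw [← Matrix.mul_kronecker_mul, one_mul]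

theorem one_kronecker_diagonal (x : Fin r → ℂ) :
    (1 : Matrix (Fin r) (Fin r) ℂ) ⊗ₖ Matrix.diagonal x =
      Matrix.diagonal fun y : Fin r × Fin r => x y.2 := by
  rw [← Matrix.diagonal_one, Matrix.diagonal_kronecker_diagonal]
  simp

theorem isEigenbasis_of_diagonalization {A : Matrix (Fin m) (Fin r × Fin r) ℂ}
    {B : Matrix (Fin r × Fin r) (Fin m) ℂ} (hB : B * A = 1) {M : Matrix (Fin r) (Fin r) ℂ}
    {x : Fin r → ℂ} {U : GL (Fin r) ℂ} (hx : Function.Injective x) (hx0 : ∀ k, x k ≠ 0)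
    (h : M * U.val = U.val * Matrix.diagonal x) :
    IsEigenbasis (A * ((1 : Matrix (Fin r) (Fin r) ℂ) ⊗ₖ M) * B)
      (A * ((1 : Matrix (Fin r) (Fin r) ℂ) ⊗ₖ U.val)) := by
  have hUU : ((1 : Matrix (Fin r) (Fin r) ℂ) ⊗ₖ U.val) *
      ((1 : Matrix (Fin r) (Fin r) ℂ) ⊗ₖ U⁻¹.val) = 1 := by
    rw [one_kronecker_mul, ← Units.val_mul, mul_inv_cancel, Units.val_one,
      Matrix.one_kronecker_one]
  refine ⟨x, hx, hx0, ?_, ?_, ?_⟩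
  · rw [forall_mulVec_col_iff, ← one_kronecker_diagonal, Matrix.mul_assoc _ B,
      ← Matrix.mul_assoc B, hB, Matrix.one_mul, Matrix.mul_assoc, Matrix.mul_assoc,
      one_kronecker_mul, one_kronecker_mul, h]
  · rw [← Matrix.mulVec_injective_iff]
    intro u v huv
    have h1 := congrArg (fun w => ((1 : Matrix (Fin r) (Fin r) ℂ) ⊗ₖ U⁻¹.val).mulVec
      (B.mulVec w)) huv
    simpa only [Matrix.mulVec_mulVec, ← Matrix.mul_assoc B, hB, Matrix.one_mul,
      mul_eq_one_comm.1 hUU, Matrix.one_mulVec] using h1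
  · intro z v hz hv
    rw [← Matrix.range_mulVecLin]
    refine ⟨z⁻¹ • ((1 : Matrix (Fin r) (Fin r) ℂ) ⊗ₖ U⁻¹.val).mulVec
      ((((1 : Matrix (Fin r) (Fin r) ℂ) ⊗ₖ M) * B).mulVec v), ?_⟩
    rw [Matrix.mulVecLin_apply, Matrix.mulVec_smul, Matrix.mulVec_mulVec, Matrix.mul_assoc A, hUU,
      Matrix.mul_one, Matrix.mulVec_mulVec, ← Matrix.mul_assoc, hv, smul_smul, inv_mul_cancel₀ hz,
      one_smul]

theorem eigenvector_eq_smul {M : Matrix (Fin r) (Fin r) ℂ} {lam : Fin r → ℂ}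
    (hlam : Function.Injective lam) {U : GL (Fin r) ℂ}
    (hU : M * U.val = U.val * Matrix.diagonal lam) {v : Fin r → ℂ} {k : Fin r}
    (hv : M.mulVec v = lam k • v) (l : Fin r) : v l = U.val l k * (U⁻¹.val.mulVec v) k := by
  set c := U⁻¹.val.mulVec v with hc
  have hvc : v = U.val.mulVec c := by
    rw [hc, Matrix.mulVec_mulVec, ← Units.val_mul, mul_inv_cancel, Units.val_one,
      Matrix.one_mulVec]
  have h1 : (Matrix.diagonal lam).mulVec c = lam k • c := by
    have h2 : U.val.mulVec ((Matrix.diagonal lam).mulVec c) = U.val.mulVec (lam k • c) := by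
      rw [Matrix.mulVec_mulVec, ← hU, ← Matrix.mulVec_mulVec, ← hvc, hv, Matrix.mulVec_smul,
        ← hvc]
    have h3 := congrArg U⁻¹.val.mulVec h2
    simpa only [Matrix.mulVec_mulVec, ← Matrix.mul_assoc, ← Units.val_mul, inv_mul_cancel,
      Units.val_one, Matrix.one_mul, Matrix.one_mulVec] using h3
  have h0 : ∀ j, j ≠ k → c j = 0 := by
    intro j hj
    have h2 := congrFun h1 j
    rw [Matrix.mulVec_diagonal, Pi.smul_apply, smul_eq_mul, ← sub_eq_zero, ← sub_mul] at h2
    exact (mul_eq_zero.1 h2).resolve_left (sub_ne_zero.2 (hlam.ne hj))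
  rw [hvc, Matrix.mulVec, dotProduct, Finset.sum_eq_single k]
  · intro j _ hj
    rw [h0 j hj, mul_zero]
  · simp

theorem isUnit_of_isUnit_probeFactor {U : Matrix (Fin r) (Fin r) ℂ}
    {P : Fin r → Matrix (Fin r) (Fin r) ℂ} (h : IsUnit (probeFactor U P)) (k : Fin r) :
    IsUnit (P k) := by
  rw [← Matrix.mulVec_injective_iff_isUnit] at h ⊢
  intro u v huv
  have h1 : (probeFactor U P).mulVec (fun y => if y.2 = k then u y.1 else 0) =
      (probeFactor U P).mulVec (fun y => if y.2 = k then v y.1 else 0) := by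
    have h2 : ∀ (w : Fin r → ℂ) (x : Fin r × Fin r),
        (probeFactor U P).mulVec (fun y => if y.2 = k then w y.1 else 0) x =
          U x.2 k * (P k).mulVec w x.1 := by
      intro w x
      simp only [Matrix.mulVec, dotProduct, probeFactor, Matrix.of_apply, mul_ite, mul_zero,
        Fintype.sum_prod_type, Finset.sum_ite_eq', Finset.mem_univ, if_true, Finset.mul_sum,
        mul_assoc]
    funext x
    rw [h2, h2, huv]
  funext j
  simpa using congrFun (h h1) (j, k)

/-- Eigenvectors for nonzero eigenvalues lie in the range of `A`, so `E = A C` with `C = B E`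
invertible and `(I ⊗ M) C = C D`. Each segment `l ↦ C (i,l) (j,k)` is therefore zero or an
eigenvector of `M` for `lam k`, hence a multiple of one column of `U`; the multiples form `P k`.
Thus `M` is diagonalizable with the eigenvalues listed by the eigenbasis itself. -/
theorem IsEigenbasis.exists_probeFactor {A : Matrix (Fin m) (Fin r × Fin r) ℂ}
    {B : Matrix (Fin r × Fin r) (Fin m) ℂ} (hB : B * A = 1) {M : Matrix (Fin r) (Fin r) ℂ}
    {E : Matrix (Fin m) (Fin r × Fin r) ℂ}
    (hE : IsEigenbasis (A * ((1 : Matrix (Fin r) (Fin r) ℂ) ⊗ₖ M) * B) E) :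
    ∃ (lam : Fin r → ℂ) (U : GL (Fin r) ℂ) (P : Fin r → GL (Fin r) ℂ),
      M * U.val = U.val * Matrix.diagonal lam ∧
      E = A * probeFactor U.val (fun k => (P k).val) ∧
      ∃ W : Matrix (Fin r × Fin r) (Fin m) ℂ, W * E = 1 := by
  obtain ⟨lam, hlam, hlam0, heig, hli, -⟩ := hE
  rw [forall_mulVec_col_iff] at heig
  set D := Matrix.diagonal fun y : Fin r × Fin r => lam y.2 with hD
  have hDD : D * Matrix.diagonal (fun y : Fin r × Fin r => (lam y.2)⁻¹) = 1 := by
    rw [hD, Matrix.diagonal_mul_diagonal]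
    simp [hlam0]
  set C := B * E with hC
  have hEAC : E = A * C := by
    have h1 : A * B * (E * D) = E * D := by
      rw [← heig]
      simp only [← Matrix.mul_assoc]
      rw [Matrix.mul_assoc A B A, hB, Matrix.mul_one]
    have h2 := congrArg (· * Matrix.diagonal (fun y : Fin r × Fin r => (lam y.2)⁻¹)) h1
    simp only [Matrix.mul_assoc, hDD, Matrix.mul_one] at h2
    exact h2.symm
  have hMC : ((1 : Matrix (Fin r) (Fin r) ℂ) ⊗ₖ M) * C = C * D := by
    have h1 := congrArg (B * ·) heig
    simpa only [← Matrix.mul_assoc, hB, Matrix.one_mul, hC] using h1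
  have hCu : IsUnit C := by
    rw [← Matrix.mulVec_injective_iff_isUnit]
    rw [← Matrix.mulVec_injective_iff] at hli
    intro u v huv
    apply hli
    have h1 := congrArg A.mulVec huv
    rwa [Matrix.mulVec_mulVec, Matrix.mulVec_mulVec, ← hEAC] at h1
  have hrow : ∀ i j k, M.mulVec (fun l => C (i, l) (j, k)) = lam k • fun l => C (i, l) (j, k) := by
    intro i j k
    funext l
    have h1 := congrFun (congrFun hMC (i, l)) (j, k)
    rw [hD, Matrix.mul_diagonal, mul_comm, Matrix.mul_apply, Fintype.sum_prod_type] at h1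
    simp only [Matrix.kroneckerMap_apply, Matrix.one_apply, ite_mul, one_mul, zero_mul,
      Finset.sum_ite_irrel, Finset.sum_const_zero, Finset.sum_ite_eq, Finset.mem_univ,
      if_true] at h1
    exact h1
  -- Any column `(j, k)` would do to represent the `k`-th eigenspace; it has a nonzero segment
  -- because `C` is invertible.
  have hex : ∀ k, ∃ i, (fun l => C (i, l) (k, k)) ≠ 0 := by
    intro k
    by_contra! h0
    have h1 : C.mulVec (Pi.single (k, k) 1) = C.mulVec 0 := by
      rw [Matrix.mulVec_zero, Matrix.mulVec_single_one]
      funext x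
      exact congrFun (h0 x.1) x.2
    have h2 := (Matrix.mulVec_injective_iff_isUnit.2 hCu) h1
    simpa using congrFun h2 (k, k)
  choose i hi using hex
  have hU := mul_eq_mul_diagonal (fun k => hrow (i k) k k)
  obtain ⟨U, hUval⟩ := isUnit_of_eigenvectors hlam hi (fun k => hrow (i k) k k)
  rw [← hUval] at hU
  have hCP : C = probeFactor U.val fun k => Matrix.of fun a j =>
      (U⁻¹.val.mulVec fun l => C (a, l) (j, k)) k := by
    ext x y
    exact eigenvector_eq_smul hlam hU (hrow x.1 y.1 y.2) x.2
  have hP : ∀ k, IsUnit (Matrix.of fun a j => (U⁻¹.val.mulVec fun l => C (a, l) (j, k)) k) :=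
    fun k => isUnit_of_isUnit_probeFactor (P := fun k => Matrix.of fun a j =>
      (U⁻¹.val.mulVec fun l => C (a, l) (j, k)) k) (by rw [← hCP]; exact hCu) k
  refine ⟨lam, U, fun k => (hP k).unit, hU, ?_, C⁻¹ * B, ?_⟩
  · rw [hEAC]
    congr 1
  · rw [Matrix.mul_assoc, ← hC, Matrix.nonsing_inv_mul _ ((Matrix.isUnit_iff_isUnit_det _).1 hCu)]

/-- For fixed `a` and `b` the hypothesis reads `U g = P'_k(a,b) • U'(:,k)`, where `g` lists the
`(a,b)` entries of `P_l F^{(l,k)}`; apply `U⁻¹`. -/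
theorem mul_subBlock_of_probeFactor_mul {U U' : GL (Fin r) ℂ}
    {P P' : Fin r → Matrix (Fin r) (Fin r) ℂ} {F : Matrix (Fin r × Fin r) (Fin r × Fin r) ℂ}
    (h : probeFactor U.val P * F = probeFactor U'.val P') (j k : Fin r) :
    P j * subBlock F j k = (U⁻¹ * U').val j k • P' k := by
  ext a b
  set g : Fin r → ℂ := fun l => (P l * subBlock F l k) a b with hg
  have h1 : U.val.mulVec g = P' k a b • fun l => U'.val l k := by
    funext l
    have h2 := congrFun (congrFun h (a, l)) (b, k)
    simp only [Matrix.mul_apply, Fintype.sum_prod_type, probeFactor, Matrix.of_apply] at h2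
    rw [Finset.sum_comm] at h2
    simp only [Matrix.mulVec, dotProduct, hg, Matrix.mul_apply, subBlock, Matrix.of_apply,
      Finset.mul_sum, Pi.smul_apply, smul_eq_mul, ← mul_assoc]
    rw [h2, mul_comm]
  have h3 := congrArg U⁻¹.val.mulVec h1
  rw [Matrix.mulVec_mulVec, ← Units.val_mul, inv_mul_cancel, Units.val_one, Matrix.one_mulVec,
    Matrix.mulVec_smul] at h3
  have h4 := congrFun h3 j
  rw [Matrix.smul_apply, smul_eq_mul, mul_comm, Units.val_mul]
  exact h4

theorem isUnit_permPi_blockDiag {K : Fin r → Matrix (Fin r) (Fin r) ℂ} (hK : ∀ l, IsUnit (K l)) :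
    IsUnit (permPi (blockDiag K)) := by
  refine IsUnit.of_mul_eq_one (permPi (blockDiag fun l => (K l)⁻¹)) ?_
  ext x y
  have h1 := congrFun (congrFun (Matrix.mul_nonsing_inv (K x.2)
    ((Matrix.isUnit_iff_isUnit_det _).1 (hK x.2))) x.1) y.1
  rw [Matrix.mul_apply] at h1 ⊢
  rw [Fintype.sum_prod_type]
  simp only [permPi, blockDiag, Matrix.submatrix_apply, Matrix.of_apply, Prod.fst_swap,
    Prod.snd_swap, ite_mul, zero_mul, Finset.sum_ite_eq, Finset.mem_univ, if_true]
  by_cases hxy : x.2 = y.2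
  · simp only [hxy, if_true] at h1 ⊢
    rw [h1]
    simp [Matrix.one_apply, Prod.ext_iff, hxy]
  · simp [hxy, Prod.ext_iff]

/-- The first core computed by the algorithm is the true one, up to gauge. -/
theorem reshape_firstCore [NeZero r] {A : Fin m → Fin r → Fin r → ℂ} {U : Matrix (Fin r) (Fin r) ℂ}
    {P K : Fin r → Matrix (Fin r) (Fin r) ℂ} {c : Fin r → ℂ} (hc : ∀ l, c l ≠ 0)
    (hK : ∀ l, P 0 * K l = c l • P l) (hJ : IsUnit (permPi (blockDiag K))) (a : Fin m) :
    Matrix.of (reshape (unfoldAngle A * probeFactor U P * (permPi (blockDiag K))⁻¹) a) =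
      (P 0).transpose * Matrix.of (A a) * (U * Matrix.diagonal fun l => (c l)⁻¹) := by
  -- Since `P l = (c l)⁻¹ • P 0 * K l`, the dependence of `P` on the eigenvalue moves into `K`. What
  -- remains is a Kronecker product, which acts on an unfolding as multiplication of the slices from
  -- both sides.
  have hfac : probeFactor U P =
      (P 0 ⊗ₖ (U * Matrix.diagonal fun l => (c l)⁻¹)) * permPi (blockDiag K) := by
    ext x y
    have h1 := congrFun (congrFun (hK y.2) x.1) y.1
    rw [Matrix.mul_apply, Matrix.smul_apply, smul_eq_mul] at h1
    rw [Matrix.mul_apply, Fintype.sum_prod_type]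
    simp only [permPi, blockDiag, Matrix.submatrix_apply, Matrix.of_apply, Prod.fst_swap,
      Prod.snd_swap, Matrix.kroneckerMap_apply, Matrix.mul_diagonal, mul_ite, mul_zero,
      Finset.sum_ite_eq', Finset.mem_univ, if_true, probeFactor]
    have h2 : P y.2 x.1 y.1 = (c y.2)⁻¹ * ∑ j, P 0 x.1 j * K y.2 j y.1 := by
      rw [h1, ← mul_assoc, inv_mul_cancel₀ (hc y.2), one_mul]
    rw [h2, Finset.mul_sum, Finset.mul_sum]
    exact Finset.sum_congr rfl fun j _ => by ring
  rw [hfac, Matrix.mul_assoc, Matrix.mul_assoc, Matrix.mul_nonsing_inv _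
    ((Matrix.isUnit_iff_isUnit_det _).1 hJ), Matrix.mul_one]
  ext i j
  simp only [reshape, unfoldAngle, Matrix.of_apply, Matrix.mul_apply, Matrix.kroneckerMap_apply,
    Fintype.sum_prod_type, Matrix.transpose_apply, Finset.sum_mul]
  rw [Finset.sum_comm]
  refine Finset.sum_congr rfl fun l _ => Finset.sum_congr rfl fun k _ => ?_
  rw [Finset.mul_sum, Finset.mul_sum, Finset.mul_sum]
  exact Finset.sum_congr rfl fun _ _ => by ring

end Probe

/-! ### Splitting ordered products -/

section Products

theorem take_ofFn_congr {H : Type*} {d : ℕ} {f g : Fin d → H} {j : ℕ}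
    (h : ∀ k : Fin d, k.1 < j → f k = g k) : (List.ofFn f).take j = (List.ofFn g).take j := by
  refine List.ext_getElem (by simp) fun i h1 h2 => ?_
  simp only [List.getElem_take, List.getElem_ofFn]
  rw [List.length_take] at h1
  exact h _ (lt_of_lt_of_le h1 (min_le_left _ _))

theorem drop_ofFn_congr {H : Type*} {d : ℕ} {f g : Fin d → H} {j : ℕ}
    (h : ∀ k : Fin d, j ≤ k.1 → f k = g k) : (List.ofFn f).drop j = (List.ofFn g).drop j := by
  refine List.ext_getElem (by simp) fun i h1 h2 => ?_
  simp only [List.getElem_drop, List.getElem_ofFn]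
  exact h _ (by simp)

theorem ofFn_prod_eq_split {H : Type*} [Monoid H] {d : ℕ} (f : Fin d → H) {m : ℕ}
    (h : m + 1 < d) :
    (List.ofFn f).prod = ((List.ofFn f).take m).prod * f ⟨m, Nat.lt_of_succ_lt h⟩ *
      f ⟨m + 1, h⟩ * ((List.ofFn f).drop (m + 2)).prod := by
  rw [← take_ofFn_prod_succ, ← take_ofFn_prod_succ, List.prod_take_mul_prod_drop]

theorem ofFn_prod_eq_midProd {H : Type*} [Monoid H] {d : ℕ} [NeZero d] (hd : 2 ≤ d)
    (f : Fin d → H) : (List.ofFn f).prod = f 0 * midProd f * f (lastMode d) := by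
  classical
  let g : Fin d → H := fun k => if IsMid k then f k else 1
  have hpre : ∀ j, j + 1 < d →
      ((List.ofFn f).take (j + 1)).prod = f 0 * ((List.ofFn g).take (j + 1)).prod := by
    intro j
    induction j with
    | zero =>
      intro h
      have h0 : (⟨0, by omega⟩ : Fin d) = 0 := rfl
      rw [take_ofFn_prod_succ f (by omega), take_ofFn_prod_succ g (by omega), h0]
      simp [g, IsMid]
    | succ j ih =>
      intro h
      rw [take_ofFn_prod_succ f (by omega), take_ofFn_prod_succ g (by omega), ih (by omega)]
      have hmid : IsMid (⟨j + 1, by omega⟩ : Fin d) := by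
        constructor
        · intro h0
          simpa using congrArg Fin.val h0
        · intro h0
          have := congrArg Fin.val h0
          simp only [lastMode] at this
          omega
      simp [g, hmid, mul_assoc]
  obtain ⟨e, rfl⟩ : ∃ e, d = e + 2 := ⟨d - 2, by omega⟩
  have hlast : (⟨e + 1, by omega⟩ : Fin (e + 2)) = lastMode (e + 2) := rfl
  have hg : g (lastMode (e + 2)) = 1 := by simp [g, IsMid]
  have hmid : midProd f = ((List.ofFn g).take (e + 1)).prod := by
    rw [midProd, ofFn_prod_eq_take, take_ofFn_prod_succ _ (by omega), hlast]
    change _ * g (lastMode (e + 2)) = _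
    rw [hg, mul_one]
  rw [hmid, ofFn_prod_eq_take, take_ofFn_prod_succ _ (by omega), hpre e (by omega), hlast]

theorem isUnit_list_prod {H : Type*} [Monoid H] {l : List H} (h : ∀ a ∈ l, IsUnit a) :
    IsUnit l.prod := by
  induction l with
  | nil => simp
  | cons a l ih =>
    rw [List.prod_cons]
    exact (h a (by simp)).mul (ih fun b hb => h b (by simp [hb]))

theorem isUnit_of_mem_ofFn {H : Type*} [Monoid H] {d : ℕ} {f : Fin d → H}
    (h : ∀ k, IsUnit (f k)) {a : H} (ha : a ∈ List.ofFn f) : IsUnit a := by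
  obtain ⟨k, rfl⟩ := (List.mem_ofFn' _ _).1 ha
  exact h k

end Products

/-! ### Unfoldings, traces and gauge changes -/

section Unfoldings

variable {m m' r : ℕ}

/-- The columns in `G` of the transpose of the unfolding `A_{[1]}`. -/
def bracketCols (A : Fin m → Fin r → Fin r → ℂ) (G : Finset (Fin m)) :
    Matrix (Fin r × Fin r) G ℂ :=
  (unfoldBracket A).transpose.submatrix id Subtype.val

/-- The two unfoldings number their columns in transposed order, so multiplying them contracts both
pairs of indices into a trace. This is the source of every factorization of a tensor slice. -/
theorem unfoldAngle_mul_bracketCols (A : Fin m → Fin r → Fin r → ℂ)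
    (Z : Fin m' → Fin r → Fin r → ℂ) (H : Matrix (Fin r) (Fin r) ℂ) (G : Finset (Fin m'))
    (a : Fin m) (b : G) :
    (unfoldAngle A * (((1 : Matrix (Fin r) (Fin r) ℂ) ⊗ₖ H) * bracketCols Z G)) a b =
      (Matrix.of (A a) * (H * Matrix.of (Z b.1))).trace := by
  simp only [Matrix.trace, Matrix.diag, Matrix.mul_apply, Fintype.sum_prod_type, unfoldAngle,
    bracketCols, unfoldBracket, Matrix.of_apply, Matrix.kroneckerMap_apply, Matrix.one_apply,
    Matrix.submatrix_apply, Matrix.transpose_apply, id, ite_mul, one_mul, zero_mul,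
    Finset.sum_ite_irrel, Finset.sum_const_zero, Finset.sum_ite_eq, Finset.mem_univ, if_true]

theorem bracketCols_of_gauge {A A' : Fin m → Fin r → Fin r → ℂ} {X Y : Matrix (Fin r) (Fin r) ℂ}
    (h : ∀ a, Matrix.of (A' a) = X * Matrix.of (A a) * Y) (G : Finset (Fin m)) :
    bracketCols A' G = (Y.transpose ⊗ₖ X) * bracketCols A G := by
  ext x b
  have h1 := congrFun (congrFun (h b.1) x.2) x.1
  simp only [Matrix.mul_apply, Matrix.of_apply, Finset.sum_mul] at h1
  simp only [bracketCols, unfoldBracket, Matrix.submatrix_apply, Matrix.transpose_apply, id,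
    Matrix.of_apply, Matrix.mul_apply, Fintype.sum_prod_type, Matrix.kroneckerMap_apply]
  rw [h1]
  exact Finset.sum_congr rfl fun i _ => Finset.sum_congr rfl fun j _ => by ring

theorem exists_equiv_of_card {G : Finset (Fin m)} (hG : G.card = r ^ 2) :
    Nonempty (Fin r × Fin r ≃ G) := by
  refine ⟨Fintype.equivOfCardEq ?_⟩
  simp [hG, sq]

theorem exists_inv_bracketCols {A : Fin m → Fin r → Fin r → ℂ}
    (hA : ∀ e : Fin r × Fin r ↪ Fin m, ((unfoldAngle A).submatrix e id).det ≠ 0)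
    {G : Finset (Fin m)} (hG : G.card = r ^ 2) :
    ∃ W : Matrix G (Fin r × Fin r) ℂ, W * bracketCols A G = 1 ∧ bracketCols A G * W = 1 := by
  obtain ⟨e⟩ := exists_equiv_of_card hG
  let e' : Fin r × Fin r ↪ Fin m := e.toEmbedding.trans (Function.Embedding.subtype _)
  set N := ((unfoldAngle A).submatrix e' id).transpose with hN
  have hdet : IsUnit N.det := by
    rw [hN, Matrix.det_transpose]
    exact (hA e').isUnit
  have hB : bracketCols A G =
      N.submatrix (Equiv.prodComm (Fin r) (Fin r)) e.symm := by
    ext x b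
    simp [hN, bracketCols, unfoldBracket, unfoldAngle, e']
  refine ⟨N⁻¹.submatrix e.symm (Equiv.prodComm (Fin r) (Fin r)), ?_, ?_⟩
  · rw [hB, Matrix.submatrix_mul_equiv, Matrix.nonsing_inv_mul _ hdet,
      Matrix.submatrix_one_equiv]
  · rw [hB, Matrix.submatrix_mul_equiv, Matrix.mul_nonsing_inv _ hdet,
      Matrix.submatrix_one_equiv]

/-- One invertible `r² × r²` minor suffices; `G` only supplies the rows for it. -/
theorem exists_leftInv_unfoldAngle {A : Fin m → Fin r → Fin r → ℂ}
    (hA : ∀ e : Fin r × Fin r ↪ Fin m, ((unfoldAngle A).submatrix e id).det ≠ 0)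
    {G : Finset (Fin m)} (hG : G.card = r ^ 2) :
    ∃ B : Matrix (Fin r × Fin r) (Fin m) ℂ, B * unfoldAngle A = 1 := by
  obtain ⟨e⟩ := exists_equiv_of_card hG
  let e' : Fin r × Fin r ↪ Fin m := e.toEmbedding.trans (Function.Embedding.subtype _)
  refine ⟨((unfoldAngle A).submatrix e' id)⁻¹ *
    (1 : Matrix (Fin m) (Fin m) ℂ).submatrix e' id, ?_⟩
  have h1 : (1 : Matrix (Fin m) (Fin m) ℂ).submatrix e' id * unfoldAngle A =
      (unfoldAngle A).submatrix e' id := by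
    ext x y
    simp [Matrix.mul_apply, Matrix.one_apply]
  rw [Matrix.mul_assoc, h1, Matrix.nonsing_inv_mul _ (hA e').isUnit]

end Unfoldings

/-! ### Factorizations of the observed slices -/

section Entries

variable {d r : ℕ} [NeZero d] {n : Fin d → ℕ}

theorem place_mem_slicePositions {d : ℕ} {n : Fin d → ℕ} (x : Index n) (i j : Fin d)
    (S : Finset (Fin (n j))) (a : Fin (n i)) (b : S) :
    place x i j a b.1 ∈ slicePositions x i j S :=
  Finset.mem_image.2 ⟨(a, b.1), by simp, rfl⟩

theorem lastMode_ne_zero (hd : 2 ≤ d) : lastMode d ≠ 0 := by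
  intro h
  have := congrArg Fin.val h
  simp only [lastMode, Fin.val_zero] at this
  omega

theorem ringTensor_place_ends (hd : 2 ≤ d) (Q : Cores n r) (x : Index n) (a : Fin (n 0))
    (b : Fin (n (lastMode d))) :
    ringTensor Q (place x 0 (lastMode d) a b) =
      (coreSlice Q 0 a * (midSlices Q x * coreSlice Q (lastMode d) b)).trace := by
  have hmid : midProd (fun k => coreSlice Q k (place x 0 (lastMode d) a b k)) = midSlices Q x := by
    classical
    rw [midSlices, midProd, midProd]
    congr 2
    funext k
    by_cases hk : IsMid k
    · simp only [hk, if_true, place, Function.update_of_ne hk.2, Function.update_of_ne hk.1]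
    · simp [hk]
  rw [ringTensor, ofFn_prod_eq_midProd hd, hmid, mul_assoc]
  simp [place, Function.update_of_ne (lastMode_ne_zero hd).symm]

theorem ringTensor_place_succ {d r : ℕ} {n : Fin d → ℕ} (Q : Cores n r) (x : Index n)
    {m : ℕ} (h : m + 1 < d) (a : Fin (n ⟨m + 1, h⟩)) (b : Fin (n ⟨m, Nat.lt_of_succ_lt h⟩)) :
    ringTensor Q (place x ⟨m + 1, h⟩ ⟨m, Nat.lt_of_succ_lt h⟩ a b) =
      (((List.ofFn fun k => coreSlice Q k (x k)).take m).prod *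
        coreSlice Q ⟨m, Nat.lt_of_succ_lt h⟩ b * coreSlice Q ⟨m + 1, h⟩ a *
        ((List.ofFn fun k => coreSlice Q k (x k)).drop (m + 2)).prod).trace := by
  have hoff : ∀ k : Fin d, k.1 < m ∨ m + 2 ≤ k.1 →
      place x ⟨m + 1, h⟩ ⟨m, Nat.lt_of_succ_lt h⟩ a b k = x k := by
    intro k hk
    rw [place, Function.update_of_ne, Function.update_of_ne] <;>
    · rintro rfl
      simp at hk
  rw [ringTensor, ofFn_prod_eq_split _ h,
    take_ofFn_congr (g := fun k => coreSlice Q k (x k)) fun k hk => by rw [hoff k (Or.inl hk)],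
    drop_ofFn_congr (g := fun k => coreSlice Q k (x k)) fun k hk => by rw [hoff k (Or.inr hk)]]
  simp [place]

variable {P : Choice n} {Q : Cores n r}

theorem obsSlice_apply {x : Index n} {i j : Fin d} {S : Finset (Fin (n j))}
    (hS : slicePositions x i j S ⊆ P.Δ) (a : Fin (n i)) (b : S) :
    obsSlice (fun y : P.Δ => ringTensor Q y.1) x i j S a b = ringTensor Q (place x i j a b.1) := by
  rw [obsSlice, Matrix.of_apply, readEntry,
    dif_pos (hS (place_mem_slicePositions x i j S a b))]

theorem obsSlice_ends (hd : 2 ≤ d) {x : Index n} {S : Finset (Fin (n (lastMode d)))}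
    (hS : slicePositions x 0 (lastMode d) S ⊆ P.Δ) :
    obsSlice (fun y : P.Δ => ringTensor Q y.1) x 0 (lastMode d) S =
      unfoldAngle (Q 0) * (((1 : Matrix (Fin r) (Fin r) ℂ) ⊗ₖ midSlices Q x) *
        bracketCols (Q (lastMode d)) S) := by
  ext a b
  rw [obsSlice_apply hS, ringTensor_place_ends hd, unfoldAngle_mul_bracketCols]
  rfl

theorem slicePositions_succ_subset (P : Choice n) {m : ℕ} (h : m + 1 < d) :
    slicePositions P.γ ⟨m + 1, h⟩ ⟨m, Nat.lt_of_succ_lt h⟩ (P.G ⟨m, Nat.lt_of_succ_lt h⟩) ⊆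
      P.Δ := by
  have hk : (⟨m + 1, h⟩ : Fin d) = ⟨m, Nat.lt_of_succ_lt h⟩ + 1 := by
    ext
    rw [Fin.val_add, Fin.val_one', Nat.mod_eq_of_lt (show 1 < d by omega), Nat.mod_eq_of_lt h]
  rw [hk]
  refine Finset.Subset.trans ?_ Finset.subset_union_right
  exact Finset.subset_biUnion_of_mem
    (fun k : Fin d => slicePositions P.γ (k + 1) k (P.G k)) (Finset.mem_univ _)

end Entries

/-! ### Probe matrices of generic cores -/

section Probes

open scoped Matrix

variable {d r : ℕ} [NeZero d] {n : Fin d → ℕ} {P : Choice n} {Q : Cores n r}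

theorem IsGeneric.isUnit_slice (hQ : IsGeneric Q) (k : Fin d) (a : Fin (n k)) :
    IsUnit (coreSlice Q k a) :=
  (Matrix.isUnit_iff_isUnit_det _).2 (hQ.slice_ne_zero k a).isUnit

theorem IsGeneric.isUnit_midSlices (hQ : IsGeneric Q) (x : Index n) : IsUnit (midSlices Q x) := by
  classical
  refine isUnit_list_prod fun a ha => isUnit_of_mem_ofFn (fun k => ?_) ha
  by_cases hk : IsMid k
  · simpa [hk] using hQ.isUnit_slice k (x k)
  · simp [hk]

/-- The quotient `R^x (R^y)⁻¹` of two products of middle slices. -/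
def sliceQuot (Q : Cores n r) (x y : Index n) : Matrix (Fin r) (Fin r) ℂ :=
  midSlices Q x * (midSlices Q y)⁻¹

theorem IsGeneric.probeMatrix_eq (hQ : IsGeneric Q) (x y : Index n) :
    (midSlices Q y).det ≠ 0 ∧ probeMatrix Q x y = (midSlices Q y).det • sliceQuot Q x y := by
  have hu := (Matrix.isUnit_iff_isUnit_det _).1 (hQ.isUnit_midSlices y)
  refine ⟨hu.ne_zero, ?_⟩
  rw [probeMatrix, sliceQuot, ← Matrix.mul_smul, Matrix.inv_def, smul_smul,
    Ring.mul_inverse_cancel _ hu, one_smul]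

theorem IsGeneric.exists_inv_probeFactor (hQ : IsGeneric Q) (y : Index n)
    {S : Finset (Fin (n (lastMode d)))} (hS : S.card = r ^ 2) :
    ∃ W : Matrix S (Fin r × Fin r) ℂ,
      W * (((1 : Matrix (Fin r) (Fin r) ℂ) ⊗ₖ midSlices Q y) *
        bracketCols (Q (lastMode d)) S) = 1 := by
  obtain ⟨W, hW, -⟩ := exists_inv_bracketCols (hQ.minor_ne_zero (lastMode d)) hS
  refine ⟨W * ((1 : Matrix (Fin r) (Fin r) ℂ) ⊗ₖ (midSlices Q y)⁻¹), ?_⟩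
  rw [Matrix.mul_assoc, ← Matrix.mul_assoc (_ ⊗ₖ _), one_kronecker_mul, Matrix.nonsing_inv_mul _
    ((Matrix.isUnit_iff_isUnit_det _).1 (hQ.isUnit_midSlices y)), Matrix.one_kronecker_one,
    Matrix.one_mul, hW]

theorem IsGeneric.exists_leftInv_obsSlice (hQ : IsGeneric Q) (hd : 2 ≤ d) (hP : P.Admissible r)
    {y : Index n} {S : Finset (Fin (n (lastMode d)))} (hS : S.card = r ^ 2)
    (hy : slicePositions y 0 (lastMode d) S ⊆ P.Δ) :
    ∃ W : Matrix S (Fin (n 0)) ℂ,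
      W * obsSlice (fun z : P.Δ => ringTensor Q z.1) y 0 (lastMode d) S = 1 := by
  obtain ⟨B, hB⟩ := exists_leftInv_unfoldAngle (hQ.minor_ne_zero 0) (hP.2.2.1 0)
  obtain ⟨W, hW⟩ := hQ.exists_inv_probeFactor y hS
  refine ⟨W * B, ?_⟩
  rw [obsSlice_ends hd hy, Matrix.mul_assoc, ← Matrix.mul_assoc B, hB, Matrix.one_mul, hW]

/-- Write the `y`-slice as `A N` with `N` square. From `X (A N) = 1` follows `(N X) A = 1`, so `B =
N X` is a left inverse of `A`; nothing else about the pseudoinverse is used. The factor of the last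
core is common to both slices and stays inside `B`. -/
theorem IsGeneric.obsSlice_mul_pinv (hQ : IsGeneric Q) (hd : 2 ≤ d) (hP : P.Admissible r)
    {x y : Index n} {S : Finset (Fin (n (lastMode d)))} (hS : S.card = r ^ 2)
    (hx : slicePositions x 0 (lastMode d) S ⊆ P.Δ) (hy : slicePositions y 0 (lastMode d) S ⊆ P.Δ)
    {X : Matrix S (Fin (n 0)) ℂ}
    (hX : IsMoorePenrose (obsSlice (fun z : P.Δ => ringTensor Q z.1) y 0 (lastMode d) S) X) :
    ∃ B : Matrix (Fin r × Fin r) (Fin (n 0)) ℂ, B * unfoldAngle (Q 0) = 1 ∧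
      obsSlice (fun z : P.Δ => ringTensor Q z.1) x 0 (lastMode d) S * X =
        unfoldAngle (Q 0) * ((1 : Matrix (Fin r) (Fin r) ℂ) ⊗ₖ sliceQuot Q x y) * B := by
  obtain ⟨W, hW⟩ := hQ.exists_leftInv_obsSlice hd hP hS hy
  have h1 := hX.mul_eq_one hW
  rw [obsSlice_ends hd hy] at h1
  refine ⟨((1 : Matrix (Fin r) (Fin r) ℂ) ⊗ₖ midSlices Q y) * bracketCols (Q (lastMode d)) S * X,
    ?_, ?_⟩
  · rw [← Matrix.mul_assoc] at h1
    rw [Matrix.mul_assoc]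
    exact (Matrix.mul_eq_one_comm_of_card_eq _ _ _ (by simp [hS, sq])).1 h1
  · have h2 : sliceQuot Q x y * midSlices Q y = midSlices Q x := by
      rw [sliceQuot, mul_assoc, Matrix.nonsing_inv_mul _
        ((Matrix.isUnit_iff_isUnit_det _).1 (hQ.isUnit_midSlices y)), mul_one]
    rw [obsSlice_ends hd hx, ← h2, ← one_kronecker_mul]
    simp only [Matrix.mul_assoc]

theorem IsGeneric.exists_diagonalization (hQ : IsGeneric Q) {α β α' β' : Index n}
    (h : ProbesDiffer α β α' β') :
    ∃ (x : Fin r → ℂ) (U : GL (Fin r) ℂ), Function.Injective x ∧ (∀ k, x k ≠ 0) ∧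
      sliceQuot Q α β * U.val = U.val * Matrix.diagonal x := by
  obtain ⟨x, U, hx, hU⟩ := TensorRing.exists_diagonalization (hQ.traceGram_ne_zero _ _ _ _ h)
  obtain ⟨hc, hN⟩ := hQ.probeMatrix_eq α β
  set c := (midSlices Q β).det
  have hM : sliceQuot Q α β * U.val = U.val * Matrix.diagonal (c⁻¹ • x) := by
    rw [hN, smul_mul_assoc] at hU
    rw [Matrix.diagonal_smul, mul_smul_comm, ← hU, smul_smul, inv_mul_cancel₀ hc, one_smul]
  refine ⟨c⁻¹ • x, U, (mul_right_injective₀ (inv_ne_zero hc)).comp hx, ?_, hM⟩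
  have hunit : IsUnit (Matrix.diagonal (c⁻¹ • x)) := by
    have h1 : IsUnit (sliceQuot Q α β * U.val) :=
      ((hQ.isUnit_midSlices α).mul (Matrix.isUnit_nonsing_inv_iff.2 (hQ.isUnit_midSlices β))).mul
        U.isUnit
    rw [hM] at h1
    exact (Units.isUnit_units_mul U _).1 h1
  intro k
  rw [Matrix.isUnit_diagonal] at hunit
  exact (Pi.isUnit_iff.1 hunit k).ne_zero

theorem IsGeneric.overlap_ne_zero (hQ : IsGeneric Q) {α β α' β' : Index n}
    (h : ProbesDiffer α β α' β') {x x' : Fin r → ℂ} {U U' : GL (Fin r) ℂ}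
    (hU : sliceQuot Q α β * U.val = U.val * Matrix.diagonal x)
    (hU' : sliceQuot Q α' β' * U'.val = U'.val * Matrix.diagonal x') (j k : Fin r) :
    (U⁻¹ * U').val j k ≠ 0 := by
  obtain ⟨-, hN⟩ := hQ.probeMatrix_eq α β
  obtain ⟨-, hN'⟩ := hQ.probeMatrix_eq α' β'
  have hdet := hQ.powProducts_ne_zero _ _ _ _ h
  have hUi : U⁻¹.val * sliceQuot Q α β = Matrix.diagonal x * U⁻¹.val := by
    calc U⁻¹.val * sliceQuot Q α β = U⁻¹.val * (sliceQuot Q α β * U.val) * U⁻¹.val := by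
          rw [mul_assoc, mul_assoc (sliceQuot Q α β), ← Units.val_mul, mul_inv_cancel,
            Units.val_one, mul_one]
      _ = Matrix.diagonal x * U⁻¹.val := by
          rw [hU, ← mul_assoc, ← Units.val_mul, inv_mul_cancel, Units.val_one, one_mul]
  have hrow : U⁻¹.val.row j ≠ 0 := by
    intro h0
    have h1 := congrFun (congrFun (Units.inv_mul U) j) j
    rw [Matrix.mul_apply, Matrix.one_apply_eq] at h1
    have h2 : ∀ i, U⁻¹.val j i = 0 := fun i => congrFun h0 i
    simp [h2] at h1
  have hcol : U'.val.col k ≠ 0 := by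
    intro h0
    have h1 := congrFun (congrFun (Units.inv_mul U') k) k
    rw [Matrix.mul_apply, Matrix.one_apply_eq] at h1
    have h2 : ∀ i, U'.val i k = 0 := fun i => congrFun h0 i
    simp [h2] at h1
  have key := dotProduct_ne_zero_of_eigenvectors hdet hrow hcol
    (z := (midSlices Q β).det * x j) (z' := (midSlices Q β').det * x' k) ?_ ?_
  · exact key
  · rw [hN, Matrix.vecMul_smul, mul_smul]
    congr 1
    funext i
    have h1 := congrFun (congrFun hUi j) i
    rw [Matrix.diagonal_mul] at h1
    exact h1
  · rw [hN', Matrix.smul_mulVec, mul_smul]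
    congr 1
    funext i
    have h1 := congrFun (congrFun hU' i) k
    rw [Matrix.mul_diagonal, mul_comm] at h1
    exact h1

end Probes

/-! ### The invariant of the algorithm and its preservation -/

section Invariant

variable {d r : ℕ} [NeZero d] {n : Fin d → ℕ}

/-- What holds after the first step. -/
def EigenInv (Q : Cores n r) (E E' : Matrix (Fin (n 0)) (Fin r × Fin r) ℂ) : Prop :=
  ∃ (U U' : GL (Fin r) ℂ) (V V' : Fin r → GL (Fin r) ℂ),
    E = unfoldAngle (Q 0) * probeFactor U.val (fun k => (V k).val) ∧
    E' = unfoldAngle (Q 0) * probeFactor U'.val (fun k => (V' k).val) ∧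
    (∃ W : Matrix (Fin r × Fin r) (Fin (n 0)) ℂ, W * E = 1) ∧
    ∀ j k, (U⁻¹ * U').val j k ≠ 0

/-- What holds after the second step. -/
def BlockInv [NeZero r] (Q : Cores n r) (E : Matrix (Fin (n 0)) (Fin r × Fin r) ℂ)
    (F : Matrix (Fin r × Fin r) (Fin r × Fin r) ℂ) : Prop :=
  ∃ (U Y : GL (Fin r) ℂ) (V : Fin r → GL (Fin r) ℂ) (v : Fin r → ℂ),
    E = unfoldAngle (Q 0) * probeFactor U.val (fun k => (V k).val) ∧ (∀ l, v l ≠ 0) ∧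
    ∀ l, (V l).val * subBlock F l 0 = v l • Y.val

/-- What holds after the third step. -/
def GaugeInv [NeZero r] (Q : Cores n r) (E : Matrix (Fin (n 0)) (Fin r × Fin r) ℂ)
    (K : Fin r → Matrix (Fin r) (Fin r) ℂ) : Prop :=
  ∃ (U : GL (Fin r) ℂ) (V : Fin r → GL (Fin r) ℂ) (c : Fin r → ℂ),
    E = unfoldAngle (Q 0) * probeFactor U.val (fun k => (V k).val) ∧ (∀ l, c l ≠ 0) ∧
    ∀ l, (V 0).val * K l = c l • (V l).val

/-- The first `m` cores of `Q'` agree with those of `Q`, up to a gauge whose components from the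
third one on are determined by the first one. -/
def CoreInv (Q : Cores n r) (γ : Index n) (m : ℕ) (Q' : Cores n r) : Prop :=
  ∃ L : ℕ → GL (Fin r) ℂ,
    (∀ k, 2 ≤ k → (L k).val =
      ((List.ofFn fun k => coreSlice Q k (γ k)).drop k).prod * (L 0).val) ∧
    ∀ k : Fin d, k.1 < m → ∀ a, coreSlice Q' k a =
      (L k.1)⁻¹.val * coreSlice Q k a * (L (k.1 + 1)).val

/-- The invariant of the algorithm. -/
def StateInv [NeZero r] (Q : Cores n r) (γ : Index n) (N : ℕ) : State n r → Prop
  | .start => N = 0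
  | .eigen E E' => N = 1 ∧ EigenInv Q E E'
  | .blocks E F => N = 2 ∧ BlockInv Q E F
  | .gauge E K => N = 3 ∧ GaugeInv Q E K
  | .cores m Q' => N = m + 3 ∧ 1 ≤ m ∧ m ≤ d ∧ CoreInv Q γ m Q'

variable {P : Choice n} {Q : Cores n r}

theorem isUnit_of_units_mul_eq_smul {X Y : GL (Fin r) ℂ} {Z : Matrix (Fin r) (Fin r) ℂ} {c : ℂ}
    (hc : c ≠ 0) (h : X.val * Z = c • Y.val) : IsUnit Z := by
  rw [← Units.isUnit_units_mul X, h]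
  exact (Units.mk0 c hc • Y).isUnit

theorem EigenInv.blockInv [NeZero r] {E E' : Matrix (Fin (n 0)) (Fin r × Fin r) ℂ}
    (h : EigenInv Q E E') {Y : Matrix (Fin r × Fin r) (Fin (n 0)) ℂ} (hY : IsMoorePenrose E Y) :
    BlockInv Q E (Y * E') := by
  obtain ⟨U, U', V, V', hE, hE', ⟨W, hW⟩, hne⟩ := h
  have h1 := hY.mul_eq_one hW
  refine ⟨U, V' 0, V, fun l => (U⁻¹ * U').val l 0, hE, fun l => hne l 0, fun l => ?_⟩
  refine mul_subBlock_of_probeFactor_mul (P := fun k => (V k).val) (P' := fun k => (V' k).val)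
    ?_ l 0
  have h2 : probeFactor U.val (fun k => (V k).val) * (Y * unfoldAngle (Q 0)) = 1 := by
    rw [mul_eq_one_comm, Matrix.mul_assoc, ← hE, h1]
  rw [hE', ← Matrix.mul_assoc Y, ← Matrix.mul_assoc, h2, Matrix.one_mul]

theorem BlockInv.isUnit_subBlock [NeZero r] {E : Matrix (Fin (n 0)) (Fin r × Fin r) ℂ}
    {F : Matrix (Fin r × Fin r) (Fin r × Fin r) ℂ} (h : BlockInv Q E F) (l : Fin r) :
    IsUnit (subBlock F l 0) := by
  obtain ⟨U, Y, V, v, -, hv, hF⟩ := h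
  exact isUnit_of_units_mul_eq_smul (hv l) (hF l)

theorem BlockInv.gaugeInv [NeZero r] {E : Matrix (Fin (n 0)) (Fin r × Fin r) ℂ}
    {F : Matrix (Fin r × Fin r) (Fin r × Fin r) ℂ} (h : BlockInv Q E F) :
    GaugeInv Q E fun l => if l = 0 then 1 else subBlock F 0 0 * (subBlock F l 0)⁻¹ := by
  have hu := h.isUnit_subBlock
  obtain ⟨U, Y, V, v, hE, hv, hF⟩ := h
  refine ⟨U, V, fun l => v 0 / v l, hE, fun l => div_ne_zero (hv 0) (hv l), fun l => ?_⟩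
  by_cases hl : l = 0
  · subst hl
    simp [div_self (hv 0)]
  · have h1 : (V l).val = v l • (Y.val * (subBlock F l 0)⁻¹) := by
      rw [← smul_mul_assoc, ← hF l, mul_assoc, Matrix.mul_nonsing_inv _
        ((Matrix.isUnit_iff_isUnit_det _).1 (hu l)), mul_one]
    simp only [hl, if_false]
    rw [h1, smul_smul, div_mul_cancel₀ _ (hv l), ← mul_assoc, hF 0, smul_mul_assoc]

theorem GaugeInv.isUnit_permPi [NeZero r] {E : Matrix (Fin (n 0)) (Fin r × Fin r) ℂ}
    {K : Fin r → Matrix (Fin r) (Fin r) ℂ} (h : GaugeInv Q E K) :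
    IsUnit (permPi (blockDiag K)) := by
  obtain ⟨U, V, c, -, hc, hK⟩ := h
  exact isUnit_permPi_blockDiag fun l => isUnit_of_units_mul_eq_smul (hc l) (hK l)

theorem GaugeInv.coreInv [NeZero r] (hQ : IsGeneric Q) (γ : Index n)
    {E : Matrix (Fin (n 0)) (Fin r × Fin r) ℂ} {K : Fin r → Matrix (Fin r) (Fin r) ℂ}
    (h : GaugeInv Q E K) :
    CoreInv Q γ 1
      (Function.update (0 : Cores n r) 0 (reshape (E * (permPi (blockDiag K))⁻¹))) := by
  have hJ := h.isUnit_permPi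
  obtain ⟨U, V, c, hE, hc, hK⟩ := h
  have hV0 : IsUnit (V 0).val.transpose := by
    rw [Matrix.isUnit_transpose]
    exact (V 0).isUnit
  have hU : IsUnit (U.val * Matrix.diagonal fun l => (c l)⁻¹) := by
    refine U.isUnit.mul (Matrix.isUnit_diagonal.2 (Pi.isUnit_iff.2 fun l => ?_))
    exact (inv_ne_zero (hc l)).isUnit
  have hsuf : ∀ k, IsUnit ((List.ofFn fun k => coreSlice Q k (γ k)).drop k).prod := fun k =>
    isUnit_list_prod fun a ha =>
      isUnit_of_mem_ofFn (fun k => hQ.isUnit_slice k (γ k)) (List.mem_of_mem_drop ha)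
  -- The components `0` and `1` are read off from `reshape_firstCore`; all later ones are already
  -- fixed here by the suffix products along `γ`.
  refine ⟨fun k => if k = 0 then hV0.unit⁻¹ else if k = 1 then hU.unit else
    (hsuf k).unit * hV0.unit⁻¹, fun k hk => ?_, fun k hk a => ?_⟩
  · have h0 : k ≠ 0 := by omega
    have h1 : k ≠ 1 := by omega
    simp [h0, h1]
  · obtain rfl : k = 0 := Fin.ext (by simpa using hk)
    have h1 := reshape_firstCore (A := Q 0) (U := U.val) (P := fun k => (V k).val) hc hK hJ a
    rw [← hE] at h1
    simpa [coreSlice] using h1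

theorem CoreInv.take_prod {d r : ℕ} {n : Fin d → ℕ} {Q Q' : Cores n r} {γ : Index n}
    {m : ℕ} {L : ℕ → GL (Fin r) ℂ}
    (hL : ∀ k : Fin d, k.1 < m → ∀ a, coreSlice Q' k a =
      (L k.1)⁻¹.val * coreSlice Q k a * (L (k.1 + 1)).val) {j : ℕ} (hj : j ≤ m) (hjd : j ≤ d) :
    ((List.ofFn fun k => coreSlice Q' k (γ k)).take j).prod =
      (L 0)⁻¹.val * ((List.ofFn fun k => coreSlice Q k (γ k)).take j).prod * (L j).val := by
  induction j with
  | zero => simp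
  | succ j ih =>
    rw [take_ofFn_prod_succ _ (by omega), take_ofFn_prod_succ _ (by omega), ih (by omega)
      (by omega), hL ⟨j, by omega⟩ (show j < m by omega)]
    have h1 : (L j).val * (L j)⁻¹.val = 1 := (L j).mul_inv
    simp only [mul_assoc]
    rw [← mul_assoc (L j).val, h1, one_mul]

theorem CoreInv.exists_inv (hQ : IsGeneric Q) (hP : P.Admissible r) {m : ℕ} (h : m + 1 < d)
    {Q' : Cores n r} (hc : CoreInv Q P.γ (m + 1) Q') :
    ∃ W : Matrix (P.G ⟨m, Nat.lt_of_succ_lt h⟩) (Fin r × Fin r) ℂ,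
      W * (((1 : Matrix (Fin r) (Fin r) ℂ) ⊗ₖ
        ((List.ofFn fun k : Fin d => coreSlice Q' k (P.γ k)).take m).prod) *
          bracketCols (Q' ⟨m, Nat.lt_of_succ_lt h⟩) (P.G ⟨m, Nat.lt_of_succ_lt h⟩)) = 1 := by
  obtain ⟨L, -, hL⟩ := hc
  have hH : IsUnit ((List.ofFn fun k : Fin d => coreSlice Q' k (P.γ k)).take m).prod := by
    rw [CoreInv.take_prod hL (Nat.le_succ m) (by omega)]
    refine ((L 0)⁻¹.isUnit.mul (isUnit_list_prod fun a ha => ?_)).mul (L m).isUnit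
    exact isUnit_of_mem_ofFn (fun k => hQ.isUnit_slice k (P.γ k)) (List.mem_of_mem_take ha)
  obtain ⟨W, hW, -⟩ := exists_inv_bracketCols (hQ.minor_ne_zero ⟨m, Nat.lt_of_succ_lt h⟩)
    (hP.2.2.1 ⟨m, Nat.lt_of_succ_lt h⟩)
  rw [bracketCols_of_gauge (hL ⟨m, Nat.lt_of_succ_lt h⟩ (Nat.lt_succ_self m)),
    ← Matrix.mul_assoc, ← Matrix.mul_kronecker_mul, Matrix.one_mul]
  have hu : IsUnit ((L (m + 1)).val.transpose ⊗ₖ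
      (((List.ofFn fun k : Fin d => coreSlice Q' k (P.γ k)).take m).prod * (L m)⁻¹.val)) := by
    rw [Matrix.isUnit_iff_isUnit_det, Matrix.det_kronecker]
    have h1 : IsUnit (L (m + 1)).val.transpose := by
      rw [Matrix.isUnit_transpose]
      exact (L (m + 1)).isUnit
    exact (((Matrix.isUnit_iff_isUnit_det _).1 h1).pow _).mul
      (((Matrix.isUnit_iff_isUnit_det _).1 (hH.mul (L m)⁻¹.isUnit)).pow _)
  obtain ⟨X, hX⟩ := hu.exists_left_inv
  refine ⟨W * X, ?_⟩
  rw [Matrix.mul_assoc, ← Matrix.mul_assoc X]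
  rw [hX, Matrix.one_mul, hW]

theorem CoreInv.next (hQ : IsGeneric Q) (hP : P.Admissible r) {m : ℕ} (h : m + 1 < d)
    {Q' : Cores n r} (hc : CoreInv Q P.γ (m + 1) Q')
    {Z : Matrix (P.G ⟨m, Nat.lt_of_succ_lt h⟩) (Fin r × Fin r) ℂ}
    (hZ : IsMoorePenrose (((1 : Matrix (Fin r) (Fin r) ℂ) ⊗ₖ
        ((List.ofFn fun k : Fin d => coreSlice Q' k (P.γ k)).take m).prod) *
          bracketCols (Q' ⟨m, Nat.lt_of_succ_lt h⟩) (P.G ⟨m, Nat.lt_of_succ_lt h⟩)) Z) :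
    CoreInv Q P.γ (m + 2) (Function.update Q' ⟨m + 1, h⟩
      (reshape (obsSlice (fun x : P.Δ => ringTensor Q x.1) P.γ ⟨m + 1, h⟩
        ⟨m, Nat.lt_of_succ_lt h⟩ (P.G ⟨m, Nat.lt_of_succ_lt h⟩) * Z))) := by
  obtain ⟨W, hW⟩ := hc.exists_inv hQ hP h
  have hZ1 := hZ.mul_eq_one hW
  -- As `P.G` has exactly `r²` elements here, the left inverse is also a right inverse, and
  -- multiplying by `Z` on the right solves the system exactly.
  rw [Matrix.mul_eq_one_comm_of_card_eq _ _ _ (by simp [hP.2.2.1, sq])] at hZ1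
  obtain ⟨L, hL0, hL⟩ := hc
  let A : Fin (n ⟨m + 1, h⟩) → Fin r → Fin r → ℂ := fun a i j =>
    ((L (m + 1))⁻¹.val * coreSlice Q ⟨m + 1, h⟩ a * (L (m + 2)).val) i j
  have hobs : obsSlice (fun x : P.Δ => ringTensor Q x.1) P.γ ⟨m + 1, h⟩
      ⟨m, Nat.lt_of_succ_lt h⟩ (P.G ⟨m, Nat.lt_of_succ_lt h⟩) =
      unfoldAngle A * (((1 : Matrix (Fin r) (Fin r) ℂ) ⊗ₖ
        ((List.ofFn fun k : Fin d => coreSlice Q' k (P.γ k)).take m).prod) *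
          bracketCols (Q' ⟨m, Nat.lt_of_succ_lt h⟩) (P.G ⟨m, Nat.lt_of_succ_lt h⟩)) := by
    ext a b
    rw [obsSlice_apply (slicePositions_succ_subset P h), ringTensor_place_succ,
      unfoldAngle_mul_bracketCols, CoreInv.take_prod hL (Nat.le_succ m) (by omega)]
    have h1 : Matrix.of (Q' ⟨m, Nat.lt_of_succ_lt h⟩ b.1) = (L m)⁻¹.val *
        coreSlice Q ⟨m, Nat.lt_of_succ_lt h⟩ b.1 * (L (m + 1)).val :=
      hL ⟨m, Nat.lt_of_succ_lt h⟩ (Nat.lt_succ_self m) b.1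
    have h2 : Matrix.of (A a) =
        (L (m + 1))⁻¹.val * coreSlice Q ⟨m + 1, h⟩ a * (L (m + 2)).val := rfl
    have i1 : ∀ (k : ℕ) (Y : Matrix (Fin r) (Fin r) ℂ), (L k).val * ((L k)⁻¹.val * Y) = Y := by
      intro k Y
      rw [← mul_assoc, ← Units.val_mul, mul_inv_cancel, Units.val_one, one_mul]
    -- `L (m + 2)` ends in `L 0`, which cancels against the `(L 0)⁻¹` in front of the computed
    -- prefix; the other gauge factors cancel in adjacent pairs or cyclically under the trace.
    rw [h1, h2, hL0 (m + 2) (by omega)]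
    set R := ((List.ofFn fun k => coreSlice Q k (P.γ k)).take m).prod
    set R' := ((List.ofFn fun k => coreSlice Q k (P.γ k)).drop (m + 2)).prod
    simp only [mul_assoc, i1]
    rw [Matrix.trace_mul_comm (L (m + 1))⁻¹.val]
    simp only [mul_assoc]
    have i2 : (L (m + 1)).val * (L (m + 1))⁻¹.val = 1 := (L (m + 1)).mul_inv
    rw [i2, mul_one, ← mul_assoc R, Matrix.trace_mul_comm]
    simp only [mul_assoc]
  refine ⟨L, hL0, fun k hk a => ?_⟩
  by_cases hkm : k = ⟨m + 1, h⟩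
  · subst hkm
    rw [hobs, Matrix.mul_assoc, hZ1, Matrix.mul_one]
    simp only [coreSlice, Function.update_self]
    rfl
  · have h1 : coreSlice (Function.update Q' ⟨m + 1, h⟩ (reshape (obsSlice (fun x : P.Δ =>
        ringTensor Q x.1) P.γ ⟨m + 1, h⟩ ⟨m, Nat.lt_of_succ_lt h⟩
        (P.G ⟨m, Nat.lt_of_succ_lt h⟩) * Z))) k a = coreSlice Q' k a := by
      simp only [coreSlice, Function.update_of_ne hkm]
    rw [h1]
    have h2 : k.1 ≠ m + 1 := fun h' => hkm (Fin.ext h')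
    exact hL k (by omega) a

theorem CoreInv.gaugeEquiv (hd : 2 ≤ d) {γ : Index n} {Q' : Cores n r}
    (hc : CoreInv Q γ d Q') : GaugeEquiv Q Q' := by
  obtain ⟨L, hL0, hL⟩ := hc
  have hLd : L d = L 0 := by
    refine Units.ext ?_
    rw [hL0 d hd, List.drop_of_length_le (by simp), List.prod_nil, one_mul]
  refine ⟨fun k => L k.1, fun k a => ?_⟩
  have hnext : L ((k + 1 : Fin d).1) = L (k.1 + 1) := by
    rw [Fin.val_add, Fin.val_one', Nat.mod_eq_of_lt (show 1 < d by omega)]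
    rcases Nat.lt_or_ge (k.1 + 1) d with hk | hk
    · rw [Nat.mod_eq_of_lt hk]
    · have : k.1 + 1 = d := by omega
      rw [this, Nat.mod_self, hLd]
  rw [hL k k.2 a]
  simp only [hnext]

theorem Choice.Admissible.probesDiffer (hP : P.Admissible r) :
    ProbesDiffer P.α P.β P.α' P.β' :=
  hP.2.2.2

theorem probe_positions_subset (P : Choice n) :
    slicePositions P.α 0 (lastMode d) P.S ⊆ P.Δ ∧ slicePositions P.β 0 (lastMode d) P.S ⊆ P.Δ ∧
    slicePositions P.α' 0 (lastMode d) P.S' ⊆ P.Δ ∧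
    slicePositions P.β' 0 (lastMode d) P.S' ⊆ P.Δ := by
  refine ⟨?_, ?_, ?_, ?_⟩ <;> intro x hx <;> simp [Choice.Δ, hx]

theorem StateInv.step [NeZero r] (hQ : IsGeneric Q) (hd : 2 ≤ d) (hP : P.Admissible r) {N : ℕ}
    {s t : State n r} (hs : StateInv Q P.γ N s)
    (hst : Step P (fun x : P.Δ => ringTensor Q x.1) s t) : StateInv Q P.γ (N + 1) t := by
  obtain ⟨h1, h2, h3, h4⟩ := probe_positions_subset P
  cases hst with
  | probes X X' E E' hX hX' hE hE' =>
    obtain rfl : N = 0 := hs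
    obtain ⟨B, hB, hT⟩ := hQ.obsSlice_mul_pinv hd hP hP.1 h1 h2 hX
    obtain ⟨B', hB', hT'⟩ := hQ.obsSlice_mul_pinv hd hP hP.2.1 h3 h4 hX'
    rw [hT] at hE
    rw [hT'] at hE'
    obtain ⟨x, U, V, hU, hEV, hW⟩ := hE.exists_probeFactor hB
    obtain ⟨x', U', V', hU', hEV', -⟩ := hE'.exists_probeFactor hB'
    exact ⟨rfl, U, U', V, V', hEV, hEV', hW, hQ.overlap_ne_zero hP.probesDiffer hU hU'⟩
  | compare E E' Y hY =>
    obtain ⟨rfl, h⟩ := hs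
    exact ⟨rfl, h.blockInv hY⟩
  | fixGauge E F hF =>
    obtain ⟨rfl, h⟩ := hs
    exact ⟨rfl, h.gaugeInv⟩
  | firstCore E K hK =>
    obtain ⟨rfl, h⟩ := hs
    exact ⟨rfl, le_rfl, by omega, h.coreInv hQ P.γ⟩
  | nextCore m h Q' Z hZ =>
    obtain ⟨rfl, -, -, hc⟩ := hs
    exact ⟨rfl, by omega, by omega, hc.next hQ hP h hZ⟩

theorem StateInv.of_runsTo [NeZero r] (hQ : IsGeneric Q) (hd : 2 ≤ d) (hP : P.Admissible r)
    {N : ℕ} {s : State n r} (h : RunsTo P (fun x : P.Δ => ringTensor Q x.1) N s) :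
    StateInv Q P.γ N s := by
  induction h with
  | init => exact rfl
  | next _ hst ih => exact ih.step hQ hd hP hst

theorem StateInv.progress [NeZero r] (hQ : IsGeneric Q) (hd : 2 ≤ d) (hP : P.Admissible r)
    {N : ℕ} {s : State n r} (hs : StateInv Q P.γ N s) :
    N ≤ d + 3 ∧
      (N < d + 3 → ∃ t : State n r, Step P (fun x : P.Δ => ringTensor Q x.1) s t) := by
  obtain ⟨h1, h2, h3, h4⟩ := probe_positions_subset P
  cases s with
  | start =>
    obtain rfl : N = 0 := hs
    refine ⟨by omega, fun _ => ?_⟩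
    obtain ⟨W, hW⟩ := hQ.exists_leftInv_obsSlice hd hP hP.1 h2
    obtain ⟨W', hW'⟩ := hQ.exists_leftInv_obsSlice hd hP hP.2.1 h4
    obtain ⟨X, hX⟩ := exists_isMoorePenrose hW
    obtain ⟨X', hX'⟩ := exists_isMoorePenrose hW'
    obtain ⟨B, hB, hT⟩ := hQ.obsSlice_mul_pinv hd hP hP.1 h1 h2 hX
    obtain ⟨B', hB', hT'⟩ := hQ.obsSlice_mul_pinv hd hP hP.2.1 h3 h4 hX'
    obtain ⟨x, U, hx, hx0, hU⟩ := hQ.exists_diagonalization hP.probesDiffer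
    obtain ⟨x', U', hx', hx0', hU'⟩ := hQ.exists_diagonalization hP.probesDiffer.swap
    exact ⟨_, Step.probes X X' _ _ hX hX'
      (by rw [hT]; exact isEigenbasis_of_diagonalization hB hx hx0 hU)
      (by rw [hT']; exact isEigenbasis_of_diagonalization hB' hx' hx0' hU')⟩
  | eigen E E' =>
    obtain ⟨rfl, h⟩ := hs
    refine ⟨by omega, fun _ => ?_⟩
    obtain ⟨_, _, _, _, _, _, ⟨W, hW⟩, _⟩ := h
    obtain ⟨Y, hY⟩ := exists_isMoorePenrose hW
    exact ⟨_, Step.compare E E' Y hY⟩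
  | blocks E F =>
    obtain ⟨rfl, h⟩ := hs
    exact ⟨by omega, fun _ => ⟨_, Step.fixGauge E F fun l _ => h.isUnit_subBlock l⟩⟩
  | gauge E K =>
    obtain ⟨rfl, h⟩ := hs
    exact ⟨by omega, fun _ => ⟨_, Step.firstCore E K h.isUnit_permPi⟩⟩
  | cores m Q' =>
    obtain ⟨rfl, hm, hmd, hc⟩ := hs
    refine ⟨by omega, fun hlt => ?_⟩
    obtain ⟨m, rfl⟩ : ∃ m', m = m' + 1 := ⟨m - 1, by omega⟩
    have h : m + 1 < d := by omega
    obtain ⟨W, hW⟩ := hc.exists_inv hQ hP h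
    obtain ⟨Z, hZ⟩ := exists_isMoorePenrose hW
    exact ⟨_, Step.nextCore m h Q' Z hZ⟩

end Invariant

/-! ### Number of observed entries and existence of admissible choices -/

section Counting

variable {d r : ℕ} [NeZero d] {n : Fin d → ℕ}

theorem card_slicePositions_le {d : ℕ} {n : Fin d → ℕ} (x : Index n) (i j : Fin d)
    (S : Finset (Fin (n j))) : (slicePositions x i j S).card ≤ n i * S.card :=
  Finset.card_image_le.trans (by simp)

theorem Choice.Admissible.card_le {P : Choice n} (hP : P.Admissible r) :
    P.Δ.card ≤ 5 * (r ^ 2 * ∑ k, n k) := by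
  have hsum : (Finset.univ.biUnion fun k : Fin d =>
      slicePositions P.γ (k + 1) k (P.G k)).card ≤ r ^ 2 * ∑ k, n k := by
    refine Finset.card_biUnion_le.trans ?_
    -- The slice with column mode `k` has `n (k + 1)` rows; the cyclic shift turns their sum into `∑
    -- n k`. The four probe slices account for the rest of the factor `5`.
    rw [Finset.mul_sum, ← Equiv.sum_comp (Equiv.addRight (1 : Fin d)) fun k => r ^ 2 * n k]
    refine Finset.sum_le_sum fun k _ => (card_slicePositions_le _ _ _ _).trans ?_
    rw [hP.2.2.1 k, mul_comm, Equiv.coe_addRight]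
  have h0 : n 0 ≤ ∑ k, n k := Finset.single_le_sum (fun _ _ => Nat.zero_le _) (Finset.mem_univ 0)
  have hmul := Nat.mul_le_mul_left (r ^ 2) h0
  have hprobe : ∀ (x : Index n) (S : Finset (Fin (n (lastMode d)))), S.card = r ^ 2 →
      (slicePositions x 0 (lastMode d) S).card ≤ r ^ 2 * ∑ k, n k := by
    intro x S hS
    refine (card_slicePositions_le _ _ _ _).trans ?_
    rw [hS, mul_comm]
    exact hmul
  have e1 := hprobe P.α P.S hP.1
  have e2 := hprobe P.β P.S hP.1
  have e3 := hprobe P.α' P.S' hP.2.1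
  have e4 := hprobe P.β' P.S' hP.2.1
  have u1 := Finset.card_union_le (slicePositions P.α 0 (lastMode d) P.S)
    (slicePositions P.β 0 (lastMode d) P.S)
  have u2 := Finset.card_union_le (slicePositions P.α' 0 (lastMode d) P.S')
    (slicePositions P.β' 0 (lastMode d) P.S')
  have u3 := Finset.card_union_le
    (slicePositions P.α 0 (lastMode d) P.S ∪ slicePositions P.β 0 (lastMode d) P.S)
    (slicePositions P.α' 0 (lastMode d) P.S' ∪ slicePositions P.β' 0 (lastMode d) P.S')
  refine (Finset.card_union_le _ _).trans ?_
  omega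

theorem exists_admissible (hd : 3 ≤ d) (hr : 2 ≤ r) (hn : ∀ k, r ^ 2 ≤ n k) :
    ∃ P : Choice n, P.Admissible r := by
  have h4 : ∀ k, 4 ≤ n k := fun k => le_trans (Nat.pow_le_pow_left hr 2) (hn k)
  have hcol : ∀ k, ∃ S : Finset (Fin (n k)), S.card = r ^ 2 := fun k => by
    obtain ⟨S, -, hS⟩ := Finset.exists_subset_card_eq
      (s := (Finset.univ : Finset (Fin (n k)))) (n := r ^ 2) (by simpa using hn k)
    exact ⟨S, hS⟩
  choose G hG using hcol
  let x : (i : ℕ) → i < 4 → Index n := fun i hi k => ⟨i, hi.trans_le (h4 k)⟩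
  -- Mode `1` is a middle mode because `d ≥ 3`. The probes share the zero index as first member, and
  -- the second members take the values `1` and `2` in this mode, which exist since every mode size
  -- is at least `4`.
  let m : Fin d := ⟨1, by omega⟩
  have hm : IsMid m := by
    constructor
    · intro h
      simpa [m] using congrArg Fin.val h
    · intro h
      have := congrArg Fin.val h
      simp only [m, lastMode] at this
      omega
  let y : (i : ℕ) → i < 4 → Index n := fun i hi =>
    Function.update (x 0 (by omega)) m (x i hi m)
  have hy : ∀ i (hi : i < 4), y i hi m = x i hi m := fun i hi => Function.update_self _ _ _
  have hlast : ∀ i (hi : i < 4), i ≠ 0 → IsLastDiff (x 0 (by omega)) (y i hi) m := by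
    intro i hi h0
    refine ⟨hm, ?_, fun k _ hk => (Function.update_of_ne hk.ne' _ _).symm⟩
    rw [hy i hi]
    intro h
    exact h0 (congrArg Fin.val h).symm
  refine ⟨⟨x 0 (by omega), y 1 (by omega), x 0 (by omega), y 2 (by omega), G _, G _,
    x 0 (by omega), G⟩, hG _, hG _, hG, m, m, hlast 1 (by omega) (by omega),
    hlast 2 (by omega) (by omega), fun _ => ⟨fun h => ?_, fun h => ?_⟩⟩
  · have h1 := h.2 m hm le_rfl
    simp only [hy] at h1
    simpa [x] using congrArg Fin.val h1
  · have h1 := h.1 m hm le_rfl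
    simp only [hy] at h1
    simpa [x] using congrArg Fin.val h1

end Counting

end TensorRing

end

open TensorRing
theorem theorem1 {d r : ℕ} [NeZero d] [NeZero r] (hd : 3 ≤ d) (hr : 2 ≤ r)
    (n : Fin d → ℕ) (hn : ∀ k, r ^ 2 ≤ n k)
    (μ : Measure (Cores n r)) [IsProbabilityMeasure μ] (hμ : μ ≪ volume) :
    -- admissible index choices exist, and each needs only `O(r² ∑ n_k)` observed entries
    (∃ P : Choice n, P.Admissible r) ∧
    (∀ P : Choice n, P.Admissible r → P.Δ.card ≤ 5 * (r ^ 2 * ∑ k, n k)) ∧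
    -- almost surely, for all admissible index choices and all choices of eigenbases, the algorithm
    -- does not get stuck, stops after exactly `d + 3` steps, and its output is correct
    ∀ᵐ Q ∂μ, ∀ P : Choice n, P.Admissible r →
      (∀ (N : ℕ) (s : State n r), RunsTo P (fun x : P.Δ => ringTensor Q x.1) N s →
        N ≤ d + 3 ∧
        (N < d + 3 → ∃ t : State n r, Step P (fun x : P.Δ => ringTensor Q x.1) s t)) ∧
      (∀ s : State n r, RunsTo P (fun x : P.Δ => ringTensor Q x.1) (d + 3) s →
        ∃ Q' : Cores n r, s = State.cores d Q' ∧ GaugeEquiv Q Q') := by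
  refine ⟨exists_admissible hd hr hn, fun P hP => hP.card_le, ?_⟩
  filter_upwards [hμ.ae_le ae_isGeneric] with Q hQ P hP
  have hd2 : 2 ≤ d := by omega
  refine ⟨fun N s hs => (StateInv.of_runsTo hQ hd2 hP hs).progress hQ hd2 hP, fun s hs => ?_⟩
  have hinv := StateInv.of_runsTo hQ hd2 hP hs
  cases s with
  | start => exact absurd (show d + 3 = 0 from hinv) (by omega)
  | eigen E E' => exact absurd hinv.1 (by omega)
  | blocks E F => exact absurd hinv.1 (by omega)
  | gauge E K => exact absurd hinv.1 (by omega)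
  | cores m Q' =>
    obtain ⟨h1, -, -, hc⟩ := hinv
    -- The invariant ties the step count to the number of computed cores, `d + 3 = m + 3`.
    obtain rfl : m = d := by omega
    exact ⟨Q', rfl, hc.gaugeEquiv hd2⟩
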